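/- Let $0<\alpha<2$, $-1\le\beta\le 1$, $x\in\mathbb{R}$ and let $n\ge 0$ be an integer. If $\alpha\ne 1$ assume $x>0$; if $\alpha=1$ assume $\beta>0$. For $\alpha\neq 1$ put $$K(\alpha)=\alpha-1+\operatorname{sign}(1-\alpha),\qquad \theta=\theta(\alpha,\beta)=\beta K(\alpha)/\alpha ,$$ and let $$\psi(z;\alpha,\beta)=\begin{cases}-z^{\alpha}\exp\left(-i\frac{\pi}{2}\theta(\alpha,\beta)\alpha\right), & \alpha\ne1,\\ -\frac{\pi}{2}z-i\beta z\log z, & \alpha=1,\end{cases}\qquad h^n(x;\alpha,\beta)=\frac1\pi\int_0^\infty (iz)^n\exp\left(izx+\psi(z;\alpha,-\beta)\right)dz .$$ Further let $$U_\alpha(\varphi;\theta)=\left(\frac{\sin\frac{\pi}{2}\alpha(\varphi+\theta)}{\cos\frac{\pi}{2}\varphi}\right)^{\alpha/(1-\alpha)}\frac{\cos\frac{\pi}{2}\{(\alpha-1)\varphi+\alpha\theta\}}{\cos\frac{\pi}{2}\varphi}\quad(\alpha\ne1),$$ $$U_1(\varphi;\beta)=\frac{\pi}{2}\,\frac{1+\beta\varphi}{\cos\frac{\pi}{2}\varphi}\exp\left(\frac{\pi}{2}\left(\varphi+\frac1\beta\right)\tan\frac{\pi}{2}\varphi\right),$$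 $$r(\varphi)=\begin{cases}\left(\dfrac{\sin\alpha(\varphi+\pi\theta/2)}{x\cos\varphi}\right)^{1/(1-\alpha)}, & \alpha\ne1,\\ \exp\left(-\frac{x}{\beta}+\left(\varphi+\frac{\pi}{2\beta}\right)\tan\varphi\right), & \alpha=1,\end{cases}\qquad \tau=\begin{cases}(\alpha/x)^{1/(1-\alpha)}, & \alpha\neq1,\\ e^{-x-1}, & \alpha=1,\end{cases}$$ $$V_n(\varphi)=r^n\left(\tfrac{\pi}{2}\varphi\right)\left\{r'\left(\tfrac{\pi}{2}\varphi\right)\sin\tfrac{\pi}{2}(n+1)(\varphi+1)+r\left(\tfrac{\pi}{2}\varphi\right)\cos\tfrac{\pi}{2}(n+1)(\varphi+1)\right\},$$ $$W_n(\varphi)=r^n\left(\tfrac{\pi}{2}\varphi\right)\left\{r\left(\tfrac{\pi}{2}\varphi\right)\sin\tfrac{\pi}{2}(n+1)(\varphi+1)-r'\left(\tfrac{\pi}{2}\varphi\right)\cos\tfrac{\pi}{2}(n+1)(\varphi+1)\right\}.$$ Then the integral defining $h^n(x;\alpha,\beta)$ converges absolutely, the integrals over $[-\theta,1]$ and $[-1,1]$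 below converge absolutely, and the following hold. (a) If $\alpha\ne1$, then $$\operatorname{Re}h^n(x;\alpha,\beta)=\frac{\operatorname{sign}(1-\alpha)}{2}\int_{-\theta}^1\exp\left(-x^{\alpha/(\alpha-1)}U_\alpha(\varphi;\theta)\right)V_n(\varphi)\,d\varphi ,$$ and if moreover $\beta\ne-1$, and $\beta\neq1$ or $\alpha>1$, then $$\operatorname{Im}h^n(x;\alpha,\beta)=\frac{\operatorname{sign}(1-\alpha)}{2}\int_{-\theta}^1\exp\left(-x^{\alpha/(\alpha-1)}U_\alpha(\varphi;\theta)\right)W_n(\varphi)\,d\varphi .$$ (b) If $\alpha=1$, then $$\operatorname{Re}h^n(x;1,\beta)=\frac12\int_{-1}^1\exp\left(-e^{-x/\beta}U_1(\varphi;\beta)\right)V_n(\varphi)\,d\varphi ,$$ and if moreover $\beta\ne1$, then $$\operatorname{Im}h^n(x;1,\beta)=\frac12\int_{-1}^1\exp\left(-e^{-x/\beta}U_1(\varphi;\beta)\right)W_n(\varphi)\,d\varphi .$$ (c) If $\alpha<1$ and $\beta=1$, then $$\operatorname{Im}h^n(x;\alpha,1)=\frac12\int_{-\theta}^1\exp\left(-x^{\alpha/(\alpha-1)}U_\alpha(\varphi;\theta)\right)W_n(\varphi)\,d\varphi-\frac1\pi\int_0^\tau\exp(xr-r^\alpha)\,r^n\,dr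 .$$ (d) If $\alpha=1$ and $\beta=1$, then $$\operatorname{Im}h^n(x;1,1)=\frac12\int_{-1}^1\exp\left(-e^{-x}U_1(\varphi;1)\right)W_n(\varphi)\,d\varphi-\frac1\pi\int_0^\tau\exp(xr+r\log r)\,r^n\,dr .$$ -/

import Mathlib

open MeasureTheory Set

noncomputable section

namespace StableDensity

/-- `K(α) = α - 1 + sign (1 - α)` (used for `α ≠ 1`). -/
def K (α : ℝ) : ℝ := α - 1 + Real.sign (1 - α)

/-- `θ = β K(α) / α` (used for `α ≠ 1`). -/
def theta (α β : ℝ) : ℝ := β * K α / α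

/-- The logarithm `ψ(z; α, β)` of the characteristic function of a one-dimensional stable law
in the (B) parameterization, extended from the positive half-axis to complex `z` with principal
branches of the power and of the logarithm. -/
def psi (z : ℂ) (α β : ℝ) : ℂ :=
  if α = 1 then
    -((Real.pi / 2 : ℝ) : ℂ) * z - Complex.I * (β : ℂ) * z * Complex.log z
  else
    -z ^ (α : ℂ) * Complex.exp (-Complex.I * ((Real.pi / 2 * theta α β * α : ℝ) : ℂ))

/-- The integrand `(iz)^n exp(izx + ψ(z; α, -β))` of `h^n(x; α, β)`. -/
def hIntegrand (n : ℕ) (x α β z : ℝ) : ℂ :=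
  (Complex.I * (z : ℂ)) ^ n *
    Complex.exp (Complex.I * (z : ℂ) * (x : ℂ) + psi (z : ℂ) α (-β))

/-- `h^n(x; α, β) = (1/π) ∫_0^∞ (iz)^n exp(izx + ψ(z; α, -β)) dz`. -/
def h (n : ℕ) (x α β : ℝ) : ℂ :=
  ((1 / Real.pi : ℝ) : ℂ) * ∫ z in Ioi (0 : ℝ), hIntegrand n x α β z

/-- `U_α(φ; θ)` for `α ≠ 1`. -/
def U (α φ θ : ℝ) : ℝ :=
  (Real.sin (Real.pi / 2 * α * (φ + θ)) / Real.cos (Real.pi / 2 * φ)) ^ (α / (1 - α)) *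
    (Real.cos (Real.pi / 2 * ((α - 1) * φ + α * θ)) / Real.cos (Real.pi / 2 * φ))

/-- `U_1(φ; β)`. -/
def U₁ (φ β : ℝ) : ℝ :=
  Real.pi / 2 * ((1 + β * φ) / Real.cos (Real.pi / 2 * φ)) *
    Real.exp (Real.pi / 2 * (φ + 1 / β) * Real.tan (Real.pi / 2 * φ))

/-- `r(φ)`; it depends on the parameters `x, α, β`. -/
def r (x α β φ : ℝ) : ℝ :=
  if α = 1 then
    Real.exp (-x / β + (φ + Real.pi / (2 * β)) * Real.tan φ)
  else
    (Real.sin (α * (φ + Real.pi * theta α β / 2)) / (x * Real.cos φ)) ^ (1 / (1 - α))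

/-- `τ`; it depends on the parameters `x, α`. -/
def tau (x α : ℝ) : ℝ :=
  if α = 1 then Real.exp (-x - 1) else (α / x) ^ (1 / (1 - α))

/-- `V_n(φ)`; `r'` is the derivative of `r` with respect to its argument `φ`. -/
def V (n : ℕ) (x α β φ : ℝ) : ℝ :=
  r x α β (Real.pi / 2 * φ) ^ n *
    (deriv (r x α β) (Real.pi / 2 * φ) * Real.sin (Real.pi / 2 * (n + 1) * (φ + 1)) +
      r x α β (Real.pi / 2 * φ) * Real.cos (Real.pi / 2 * (n + 1) * (φ + 1)))

/-- `W_n(φ)`. -/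
def W (n : ℕ) (x α β φ : ℝ) : ℝ :=
  r x α β (Real.pi / 2 * φ) ^ n *
    (r x α β (Real.pi / 2 * φ) * Real.sin (Real.pi / 2 * (n + 1) * (φ + 1)) -
      deriv (r x α β) (Real.pi / 2 * φ) * Real.cos (Real.pi / 2 * (n + 1) * (φ + 1)))

/-- The exponential weight `exp(-x^{α/(α-1)} U_α(φ; θ))` for `α ≠ 1`. -/
def weight (x α β φ : ℝ) : ℝ :=
  Real.exp (-(x ^ (α / (α - 1)) * U α φ (theta α β)))

/-- The exponential weight `exp(-e^{-x/β} U_1(φ; β))` for `α = 1`. -/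
def weight₁ (x β φ : ℝ) : ℝ :=
  Real.exp (-(Real.exp (-x / β) * U₁ φ β))

end StableDensity

end

/-! ### Primitives of holomorphic functions on the slit plane. -/

noncomputable section

namespace StableDensity

open Filter Topology

/-! The integrand of `h` extends holomorphically to the slit plane, and the half-line of integration
is deformed to the curve on which the exponent `izx + ψ(z; α, -β)` is real. In polar coordinates `z
= ρ e^{iφ}` the vanishing of its imaginary part can be solved for `ρ`, and the solution is `ρ =
r(φ)`. On the curve the exponential becomes the positive weight `exp(-x^{α/(α-1)} U_α)` or
`exp(-e^{-x/β} U_1)`. The remaining factor is `(iz)^n dz = r^n (r - i r') e^{i(n+1)(φ+π/2)} dφ`,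
whose real and imaginary parts are `V_n` and `W_n` after rescaling the angle by `π/2`.

The deformation uses no closed contours. The radial primitive `G` of the integrand satisfies `G' =
f` on the slit plane (`SlitHolomorphic.hasDerivAt_radialPrimitive`), so the integral along the curve
is the difference of the limits of `G` at its two ends (`PolarCurve.integral_pullback`). If the
curve runs to infinity where the integrand decays, `G` tends to `∫_0^∞ f`
(`SectorDecay.tendsto_radialPrimitive`); if it runs to the origin, `G` tends to `0`; if it stops at
a point `±iτ` of the imaginary axis, `G` tends to the integral of `f` over the segment from `0`.

For `α ≤ 1` the radius increases to infinity at angle `π/2`; for `α > 1` it decreases from infinity,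
which accounts for `sign(1-α)`. A stop at `±iτ` occurs only for extreme `β`. There `f` is real on
the segment and `dz = ±i ds`, so the correction is purely imaginary: real parts never see it, and it
is the extra integral over `[0, τ]` in the imaginary parts for `β = 1`, `α ≤ 1`.

Absolute convergence along the curve comes from monotonicity of `r`: a decay `O((1+|z|)⁻²)` leaves
`|r'|/(1+r)²`, which is up to sign the derivative of a bounded monotone function. -/

/-- The radial primitive `z ↦ ∫₀¹ z f(tz) dt` of a function `f`. -/
def radialPrimitive (f : ℂ → ℂ) (z : ℂ) : ℂ := z * ∫ t in (0 : ℝ)..1, f (t * z)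

/-- `f` is holomorphic on the slit plane and bounded on its bounded subsets. -/
structure SlitHolomorphic (f : ℂ → ℂ) : Prop where
  diff : DifferentiableOn ℂ f Complex.slitPlane
  bdd : ∀ M : ℝ, ∃ C : ℝ, ∀ w ∈ Complex.slitPlane, ‖w‖ ≤ M → ‖f w‖ ≤ C

theorem ofReal_mul_mem_slitPlane {z : ℂ} (hz : z ∈ Complex.slitPlane) {t : ℝ} (ht : 0 < t) :
    (t : ℂ) * z ∈ Complex.slitPlane := by
  rw [Complex.mem_slitPlane_iff] at hz ⊢
  simp only [Complex.re_ofReal_mul, Complex.im_ofReal_mul]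
  rcases hz with h | h
  · exact Or.inl (mul_pos ht h)
  · exact Or.inr (mul_ne_zero ht.ne' h)

theorem norm_ofReal_mul_le {t : ℝ} (ht : t ∈ Ioc (0 : ℝ) 1) (z : ℂ) : ‖(t : ℂ) * z‖ ≤ ‖z‖ := by
  rw [norm_mul, Complex.norm_real, Real.norm_of_nonneg ht.1.le]
  exact mul_le_of_le_one_left (norm_nonneg _) ht.2

namespace SlitHolomorphic

variable {f : ℂ → ℂ}

theorem continuousOn_ray (hf : SlitHolomorphic f) {z : ℂ} (hz : z ∈ Complex.slitPlane) :
    ContinuousOn (fun t : ℝ => f (t * z)) (Ioi 0) := by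
  refine hf.diff.continuousOn.comp (by fun_prop) ?_
  intro t ht
  exact ofReal_mul_mem_slitPlane hz ht

theorem intervalIntegrable_ray (hf : SlitHolomorphic f) {z : ℂ} (hz : z ∈ Complex.slitPlane) :
    IntervalIntegrable (fun t : ℝ => f (t * z)) volume 0 1 := by
  obtain ⟨C, hC⟩ := hf.bdd ‖z‖
  rw [intervalIntegrable_iff_integrableOn_Ioc_of_le zero_le_one]
  refine IntegrableOn.of_bound (by simp) ?_ C ?_
  · exact ((hf.continuousOn_ray hz).mono Ioc_subset_Ioi_self).aestronglyMeasurable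
      measurableSet_Ioc
  · refine (ae_restrict_iff' measurableSet_Ioc).2 (Eventually.of_forall fun t ht => ?_)
    exact hC _ (ofReal_mul_mem_slitPlane hz ht.1) (norm_ofReal_mul_le ht z)

/-- Differentiation under the integral sign gives `∫₀¹ (f(tz) + t z f'(tz)) dt`, and this integrand
is the `t`-derivative of `t f(tz)`. Mere boundedness of `f` near `0` suffices. -/
theorem hasDerivAt_radialPrimitive (hf : SlitHolomorphic f) {z : ℂ}
    (hz : z ∈ Complex.slitPlane) : HasDerivAt (radialPrimitive f) (f z) z := by
  obtain ⟨ε, hε, hball⟩ : ∃ ε > 0, Metric.closedBall z (2 * ε) ⊆ Complex.slitPlane := by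
    obtain ⟨ε, hε, h⟩ := Metric.isOpen_iff.1 Complex.isOpen_slitPlane z hz
    exact ⟨ε / 4, by positivity, (Metric.closedBall_subset_ball (by linarith)).trans h⟩
  obtain ⟨C, hC⟩ := hf.bdd (‖z‖ + 2 * ε)
  have hdiffAt : ∀ w ∈ Complex.slitPlane, HasDerivAt f (deriv f w) w := fun w hw =>
    (hf.diff.differentiableAt (Complex.isOpen_slitPlane.mem_nhds hw)).hasDerivAt
  have hray : ∀ (t : ℝ), 0 < t → ∀ w ∈ Complex.slitPlane,
      HasDerivAt (fun u : ℂ => f (t * u)) (t * deriv f (t * w)) w := by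
    intro t ht w hw
    have h1 : HasDerivAt (fun u : ℂ => (t : ℂ) * u) (t : ℂ) w := by
      simpa using (hasDerivAt_id w).const_mul (t : ℂ)
    have := (hdiffAt _ (ofReal_mul_mem_slitPlane hw ht)).comp w h1
    rwa [mul_comm] at this
  have hcont' : ContinuousOn (fun t : ℝ => (t : ℂ) * deriv f (t * z)) (Ioi 0) := by
    refine ContinuousOn.mul (by fun_prop) ?_
    refine (hf.diff.deriv Complex.isOpen_slitPlane).continuousOn.comp (by fun_prop) ?_
    intro t ht
    exact ofReal_mul_mem_slitPlane hz ht
  have key := intervalIntegral.hasDerivAt_integral_of_dominated_loc_of_deriv_le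
    (μ := volume) (a := 0) (b := 1) (F := fun (u : ℂ) (t : ℝ) => f (t * u))
    (F' := fun (u : ℂ) (t : ℝ) => t * deriv f (t * u)) (x₀ := z) (s := Metric.ball z ε)
    (bound := fun _ => C / ε) (Metric.ball_mem_nhds z hε) ?_
    (hf.intervalIntegrable_ray hz) ?_ ?_ intervalIntegrable_const ?_
  · obtain ⟨hint, hder⟩ := key
    have h2 := (hasDerivAt_id z).mul hder
    refine h2.congr_deriv ?_
    -- The boundary term at `t = 0` is a one-sided limit: `f` need not extend continuously to `0`,
    -- but `t f(tz)` tends to `0` because `f` is bounded there.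
    have h3 : ∫ t in (0 : ℝ)..1, (f (t * z) + z * (t * deriv f (t * z))) = f z - 0 := by
      refine intervalIntegral.integral_eq_sub_of_hasDerivAt_of_tendsto (f := fun t : ℝ =>
        (t : ℂ) * f (t * z)) zero_lt_one ?_ ?_ ?_ ?_
      · intro t ht
        have hc : HasDerivAt (fun s : ℝ => (s : ℂ)) 1 t := Complex.ofRealCLM.hasDerivAt
        have h1 : HasDerivAt (fun s : ℝ => (s : ℂ) * z) z t := by
          simpa using hc.mul_const z
        have h4 := (hdiffAt _ (ofReal_mul_mem_slitPlane hz ht.1)).comp t h1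
        refine (hc.mul h4).congr_deriv ?_
        simp only [Function.comp_apply]
        ring
      · exact (hf.intervalIntegrable_ray hz).add (hint.const_mul z)
      · rw [tendsto_zero_iff_norm_tendsto_zero]
        have hb : Tendsto (fun t : ℝ => |t| * C) (𝓝[>] 0) (𝓝 0) := by
          have : Tendsto (fun t : ℝ => |t| * C) (𝓝 0) (𝓝 (|0| * C)) :=
            Continuous.tendsto (by fun_prop) _
          simp only [abs_zero, zero_mul] at this
          exact this.mono_left nhdsWithin_le_nhds
        refine squeeze_zero' (Eventually.of_forall fun _ => norm_nonneg _) ?_ hb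
        filter_upwards [Ioc_mem_nhdsGT (zero_lt_one : (0 : ℝ) < 1)] with t ht
        rw [norm_mul, Complex.norm_real, Real.norm_eq_abs]
        gcongr
        exact hC _ (ofReal_mul_mem_slitPlane hz ht.1)
          ((norm_ofReal_mul_le ht z).trans (by linarith))
      · have hc : ContinuousAt (fun t : ℝ => (t : ℂ) * f (t * z)) 1 := by
          refine ContinuousAt.mul (by fun_prop) ?_
          exact (hf.continuousOn_ray hz).continuousAt (Ioi_mem_nhds zero_lt_one)
        have := hc.tendsto.mono_left (nhdsWithin_le_nhds (s := Iio 1))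
        simpa using this
    rw [sub_zero, intervalIntegral.integral_add (hf.intervalIntegrable_ray hz)
      (hint.const_mul z), intervalIntegral.integral_const_mul] at h3
    simpa using h3
  · filter_upwards [Complex.isOpen_slitPlane.mem_nhds hz] with w hw
    exact (intervalIntegrable_iff.1 (hf.intervalIntegrable_ray hw)).aestronglyMeasurable
  · rw [uIoc_of_le zero_le_one]
    exact (hcont'.mono Ioc_subset_Ioi_self).aestronglyMeasurable measurableSet_Ioc
  · rw [uIoc_of_le zero_le_one]
    refine Eventually.of_forall fun t ht w hw => ?_
    have hsub : Metric.closedBall w ε ⊆ Metric.closedBall z (2 * ε) := by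
      refine Metric.closedBall_subset_closedBall' ?_
      have := Metric.mem_ball.1 hw
      linarith
    have hw' : w ∈ Complex.slitPlane :=
      hball (hsub (Metric.mem_closedBall_self hε.le))
    rw [← (hray t ht.1 w hw').deriv]
    -- Cauchy's estimate is applied to `u ↦ f(tu)` on a disc of radius `ε` independent of `t`, so
    -- the bound `C / ε` is uniform in `t` although `f'` alone may blow up at `0`.
    refine Complex.norm_deriv_le_of_forall_mem_sphere_norm_le hε ?_ ?_
    · refine DifferentiableOn.diffContOnCl_ball (U := Complex.slitPlane) ?_ (hsub.trans hball)
      exact fun u hu => (hray t ht.1 u hu).differentiableAt.differentiableWithinAt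
    · intro u hu
      have hu' := hsub (Metric.sphere_subset_closedBall hu)
      refine hC _ (ofReal_mul_mem_slitPlane (hball hu') ht.1) ((norm_ofReal_mul_le ht u).trans ?_)
      have := norm_le_norm_add_norm_sub' u z
      rw [Metric.mem_closedBall, dist_eq_norm] at hu'
      linarith
  · rw [uIoc_of_le zero_le_one]
    refine Eventually.of_forall fun t ht w hw => hray t ht.1 w (hball ?_)
    exact Metric.ball_subset_closedBall (Metric.ball_subset_ball (by linarith) hw)

theorem tendsto_radialPrimitive_zero (hf : SlitHolomorphic f) {ι : Type*} {l : Filter ι}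
    {γ : ι → ℂ} (hγ : Tendsto γ l (𝓝 0)) (hs : ∀ᶠ i in l, γ i ∈ Complex.slitPlane) :
    Tendsto (fun i => radialPrimitive f (γ i)) l (𝓝 0) := by
  obtain ⟨C, hC⟩ := hf.bdd 1
  rw [tendsto_zero_iff_norm_tendsto_zero]
  have h0 : Tendsto (fun i => ‖γ i‖ * C) l (𝓝 0) := by
    simpa using (tendsto_zero_iff_norm_tendsto_zero.1 hγ).mul_const C
  refine squeeze_zero' (Eventually.of_forall fun _ => norm_nonneg _) ?_ h0
  filter_upwards [hs, (tendsto_zero_iff_norm_tendsto_zero.1 hγ).eventually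
    (gt_mem_nhds zero_lt_one)] with i hi h1
  rw [radialPrimitive, norm_mul]
  gcongr
  have := intervalIntegral.norm_integral_le_of_norm_le_const (a := 0) (b := 1) (C := C)
    (f := fun t : ℝ => f (t * γ i)) ?_
  · simpa using this
  · intro t ht
    rw [uIoc_of_le zero_le_one] at ht
    exact hC _ (ofReal_mul_mem_slitPlane hi ht.1) ((norm_ofReal_mul_le ht _).trans h1.le)

/-- The substitution `s = tR` shows the primitive as a contour integral over the segment from `0` to
`Rz`. -/
theorem radialPrimitive_ofReal_mul (f : ℂ → ℂ) {R : ℝ} (hR : 0 < R) (z : ℂ) :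
    radialPrimitive f (R * z) = z * ∫ s in (0 : ℝ)..R, f (s * z) := by
  have h := intervalIntegral.integral_comp_mul_right (a := 0) (b := 1)
    (fun s : ℝ => f (s * z)) hR.ne'
  have h2 : ∀ t : ℝ, ((t * R : ℝ) : ℂ) * z = t * (R * z) := fun t => by push_cast; ring
  simp only [h2, zero_mul, one_mul] at h
  rw [radialPrimitive, h, Complex.real_smul, Complex.ofReal_inv, mul_comm (R : ℂ) z, mul_assoc,
    mul_inv_cancel_left₀ (Complex.ofReal_ne_zero.2 hR.ne')]

end SlitHolomorphic

/-! ### Decay in a sector and the value of the primitive at infinity. -/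

/-- The point with polar coordinates `(ρ, φ)`. -/
def polar (ρ φ : ℝ) : ℂ := ρ * Complex.exp (φ * Complex.I)

theorem norm_polar {ρ : ℝ} (hρ : 0 ≤ ρ) (φ : ℝ) : ‖polar ρ φ‖ = ρ := by
  rw [polar, norm_mul, Complex.norm_exp_ofReal_mul_I, mul_one, Complex.norm_real,
    Real.norm_of_nonneg hρ]

theorem polar_mem_slitPlane {ρ φ : ℝ} (hρ : 0 < ρ) (hφ : φ ∈ Ioo (-Real.pi) Real.pi) :
    polar ρ φ ∈ Complex.slitPlane := by
  refine ofReal_mul_mem_slitPlane ?_ hρ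
  rw [Complex.mem_slitPlane_iff_arg]
  refine ⟨?_, Complex.exp_ne_zero _⟩
  rw [Complex.exp_mul_I, Complex.arg_cos_add_sin_mul_I ⟨hφ.1, hφ.2.le⟩]
  exact hφ.2.ne

theorem continuous_polar : Continuous fun p : ℝ × ℝ => polar p.1 p.2 := by
  unfold polar
  fun_prop

theorem hasDerivAt_polar {ρ : ℝ → ℝ} {ρ' φ : ℝ} (h : HasDerivAt ρ ρ' φ) :
    HasDerivAt (fun φ => polar (ρ φ) φ)
      ((ρ' + Complex.I * ρ φ) * Complex.exp (φ * Complex.I)) φ := by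
  have h1 : HasDerivAt (fun φ : ℝ => (φ : ℂ) * Complex.I) Complex.I φ := by
    simpa using (Complex.ofRealCLM.hasDerivAt (x := φ)).mul_const Complex.I
  refine (h.ofReal_comp.mul h1.cexp).congr_deriv ?_
  ring

/-- Decay `O((1 + |z|)⁻²)` in the sector with the set of angles `S`, which contains the positive
half-axis and is contained in the right half-plane. -/
structure SectorDecay (f : ℂ → ℂ) (S : Set ℝ) : Prop extends SlitHolomorphic f where
  convex : Convex ℝ S
  zero_mem : (0 : ℝ) ∈ S
  subset : S ⊆ Icc (-(Real.pi / 2)) (Real.pi / 2)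
  decay : ∃ C R₀ : ℝ, ∀ R ≥ R₀, ∀ η ∈ S, ‖f (polar R η)‖ ≤ C / (1 + R) ^ 2

theorem Icc_half_pi_subset : Icc (-(Real.pi / 2)) (Real.pi / 2) ⊆ Ioo (-Real.pi) Real.pi := by
  intro φ hφ
  have := Real.pi_pos
  exact ⟨by linarith [hφ.1], by linarith [hφ.2]⟩

namespace SectorDecay

variable {f : ℂ → ℂ} {S : Set ℝ}

/-- Decay at large radii and boundedness at small ones merge into a single estimate; the angle has
to lie in `S` only beyond `R₁`. -/
theorem exists_bound (hf : SectorDecay f S) (R₁ : ℝ) :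
    ∃ C : ℝ, 0 ≤ C ∧ ∀ R > 0, ∀ η ∈ Ioo (-Real.pi) Real.pi, (R₁ < R → η ∈ S) →
      ‖f (polar R η)‖ ≤ C / (1 + R) ^ 2 := by
  obtain ⟨C, R₂, hC⟩ := hf.decay
  set R₀ := max R₁ R₂
  obtain ⟨D, hD⟩ := hf.bdd R₀
  refine ⟨max C (max 0 (D * (1 + R₀) ^ 2)), by simp, fun R hR η hη hS => ?_⟩
  rcases lt_or_ge R₀ R with h | h
  · refine (hC R ((le_max_right _ _).trans h.le) η (hS ((le_max_left _ _).trans_lt h))).trans ?_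
    gcongr
    exact le_max_left _ _
  · have h1 := hD _ (polar_mem_slitPlane hR hη) (by rwa [norm_polar hR.le])
    rw [le_div_iff₀ (by positivity)]
    have hD0 : 0 ≤ D := (norm_nonneg _).trans h1
    calc ‖f (polar R η)‖ * (1 + R) ^ 2 ≤ D * (1 + R₀) ^ 2 := by gcongr
      _ ≤ _ := (le_max_right _ _).trans (le_max_right _ _)

theorem integrableOn (hf : SectorDecay f S) :
    IntegrableOn (fun t : ℝ => f t) (Ioi 0) := by
  obtain ⟨C, -, hC⟩ := hf.exists_bound 0
  have h0 : ∀ t : ℝ, polar t 0 = t := fun t => by simp [polar]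
  have hi : IntegrableOn (fun t : ℝ => C * (t + 1) ^ (-2 : ℝ)) (Ioi 0) :=
    (integrableOn_add_rpow_Ioi_of_lt (by norm_num) (by norm_num)).const_mul C
  refine Integrable.mono' hi ?_ ?_
  · have := hf.continuousOn_ray (z := 1) (by simp)
    simp only [mul_one] at this
    exact this.aestronglyMeasurable measurableSet_Ioi
  · refine (ae_restrict_iff' measurableSet_Ioi).2 (Eventually.of_forall fun t ht => ?_)
    have := hC t ht 0 (Icc_half_pi_subset (hf.subset hf.zero_mem)) (fun _ => hf.zero_mem)
    have ht : (0 : ℝ) < t := ht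
    rw [h0] at this
    rw [Real.rpow_neg (by linarith), ← div_eq_mul_inv, add_comm t 1]
    exact_mod_cast this

theorem tendsto_radialPrimitive_ofReal (hf : SectorDecay f S) :
    Tendsto (fun R : ℝ => radialPrimitive f R) atTop (𝓝 (∫ t in Ioi (0 : ℝ), f t)) := by
  refine (intervalIntegral_tendsto_integral_Ioi 0 hf.integrableOn tendsto_id).congr' ?_
  filter_upwards [eventually_gt_atTop 0] with R hR
  have := SlitHolomorphic.radialPrimitive_ofReal_mul f hR 1
  simpa using this.symm

/-- The values of the primitive at points going to infinity inside the sector tend to the integral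
over the positive half-axis. -/
theorem tendsto_radialPrimitive (hf : SectorDecay f S) {ι : Type*} {l : Filter ι}
    {ρ φ : ι → ℝ} (hρ : Tendsto ρ l atTop) (hφ : ∀ᶠ i in l, φ i ∈ S) :
    Tendsto (fun i => radialPrimitive f (polar (ρ i) (φ i))) l
      (𝓝 (∫ t in Ioi (0 : ℝ), f t)) := by
  obtain ⟨C, hC0, hC⟩ := hf.exists_bound 0
  have hmain := hf.tendsto_radialPrimitive_ofReal.comp hρ
  have hdiff : Tendsto (fun i => radialPrimitive f (polar (ρ i) (φ i)) -
      radialPrimitive f (ρ i)) l (𝓝 0) := by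
    rw [tendsto_zero_iff_norm_tendsto_zero]
    have hlim : Tendsto (fun i => C * Real.pi / (1 + ρ i)) l (𝓝 0) :=
      Tendsto.const_div_atTop (tendsto_atTop_add_const_left _ 1 hρ) _
    refine squeeze_zero' (Eventually.of_forall fun _ => norm_nonneg _) ?_ hlim
    filter_upwards [hφ, hρ.eventually_gt_atTop 0] with i hi hpos
    -- The two values differ by the integral over a circular arc, of length at most `πρ`, on which
    -- the integrand is `O((1+ρ)⁻²)`. The mean value inequality in the angle replaces that integral.
    have hmv := hf.convex.norm_image_sub_le_of_norm_hasDerivWithin_le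
      (f := fun η : ℝ => radialPrimitive f (polar (ρ i) η))
      (f' := fun η : ℝ => f (polar (ρ i) η) * (Complex.I * ρ i * Complex.exp (η * Complex.I)))
      (C := C / (1 + ρ i)) (fun η hη => ?_) (fun η hη => ?_) hf.zero_mem hi
    · have h0 : polar (ρ i) 0 = ρ i := by simp [polar]
      rw [h0] at hmv
      refine hmv.trans ?_
      rw [sub_zero, Real.norm_eq_abs, mul_div_right_comm]
      gcongr
      have := Real.pi_pos
      exact abs_le.2 ⟨by linarith [(hf.subset hi).1], by linarith [(hf.subset hi).2]⟩
    · have h1 := hf.hasDerivAt_radialPrimitive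
        (polar_mem_slitPlane hpos (Icc_half_pi_subset (hf.subset hη)))
      have h2 := hasDerivAt_polar (hasDerivAt_const η (ρ i))
      refine ((h1.comp η h2).congr_deriv ?_).hasDerivWithinAt
      push_cast
      ring
    · have h3 := hC _ hpos η (Icc_half_pi_subset (hf.subset hη)) (fun _ => hη)
      rw [norm_mul, norm_mul, norm_mul, Complex.norm_I, Complex.norm_exp_ofReal_mul_I,
        Complex.norm_real, Real.norm_of_nonneg hpos.le, one_mul, mul_one]
      calc ‖f (polar (ρ i) η)‖ * ρ i ≤ C / (1 + ρ i) ^ 2 * (1 + ρ i) := by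
            gcongr
            linarith
        _ = C / (1 + ρ i) := by field_simp
  have := hmain.add hdiff
  simpa using this

end SectorDecay

/-! ### Contour integrals along curves with monotone modulus. -/

/-- The derivative of a bounded function with nonnegative derivative on an open interval is
integrable. -/
theorem intervalIntegrable_of_hasDerivAt_of_nonneg {k k' : ℝ → ℝ} {a b m M : ℝ} (hab : a < b)
    (hk : ∀ t ∈ Ioo a b, HasDerivAt k (k' t) t) (hk' : ∀ t ∈ Ioo a b, 0 ≤ k' t)
    (hm : ∀ t ∈ Ioo a b, m ≤ k t) (hM : ∀ t ∈ Ioo a b, k t ≤ M) :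
    IntervalIntegrable k' volume a b := by
  have hmono : MonotoneOn k (Ioo a b) := by
    refine monotoneOn_of_hasDerivWithinAt_nonneg (f' := k') (convex_Ioo a b)
      (fun t ht => (hk t ht).continuousAt.continuousWithinAt) ?_ ?_
    · intro t ht
      rw [interior_Ioo] at ht ⊢
      exact (hk t ht).hasDerivWithinAt
    · intro t ht
      rw [interior_Ioo] at ht
      exact hk' t ht
  have hmM : m ≤ M := by
    obtain ⟨t, ht⟩ := nonempty_Ioo.2 hab
    exact (hm t ht).trans (hM t ht)
  -- Extending `k` by its bounds gives a monotone function on the whole line, whose derivative is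
  -- integrable on compact intervals.
  set g : ℝ → ℝ := fun t => if t ≤ a then m else if b ≤ t then M else k t with hg
  have hgk : ∀ t ∈ Ioo a b, g t = k t := fun t ht => by
    simp [hg, ht.1.not_ge, ht.2.not_ge]
  have hgm : Monotone g := by
    intro s t hst
    simp only [hg]
    split_ifs with h1 h2 h3 h4 h5 h6 h7 h8
    · exact le_rfl
    · exact hmM
    · exact hm t ⟨not_le.1 h2, not_le.1 h3⟩
    · exact absurd (hst.trans h5) h1
    · exact le_rfl
    · exact absurd (h4.trans hst) h6
    · exact absurd (hst.trans h7) h1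
    · exact hM s ⟨not_le.1 h1, not_le.1 h4⟩
    · exact hmono ⟨not_le.1 h1, not_le.1 h4⟩ ⟨not_le.1 h7, not_le.1 h8⟩ hst
  have hint := (hgm.monotoneOn (uIcc a b)).intervalIntegrable_deriv
  rw [intervalIntegrable_iff_integrableOn_Ioo_of_le hab.le] at hint ⊢
  refine hint.congr_fun (fun t ht => ?_) measurableSet_Ioo
  refine ((hk t ht).congr_of_eventuallyEq ?_).deriv
  filter_upwards [Ioo_mem_nhds ht.1 ht.2] with s hs using hgk s hs

/-- A curve `φ ↦ ρ(φ) e^{iφ}` in the right half-plane, whose modulus is a monotone function of the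
angle, and whose angle belongs to `S` where the modulus is large. -/
structure PolarCurve (ρ ρ' : ℝ → ℝ) (a b : ℝ) (S : Set ℝ) : Prop where
  lt : a < b
  left : -(Real.pi / 2) ≤ a
  right : b ≤ Real.pi / 2
  pos : ∀ φ ∈ Ioo a b, 0 < ρ φ
  hasDerivAt : ∀ φ ∈ Ioo a b, HasDerivAt ρ (ρ' φ) φ
  monotone : (∀ φ ∈ Ioo a b, 0 ≤ ρ' φ) ∨ (∀ φ ∈ Ioo a b, ρ' φ ≤ 0)
  large : ∃ R₀ : ℝ, ∀ φ ∈ Ioo a b, R₀ < ρ φ → φ ∈ S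

namespace PolarCurve

variable {f : ℂ → ℂ} {S : Set ℝ} {ρ ρ' : ℝ → ℝ} {a b : ℝ}

theorem mem_slitPlane (hρ : PolarCurve ρ ρ' a b S) {φ : ℝ} (hφ : φ ∈ Ioo a b) :
    polar (ρ φ) φ ∈ Complex.slitPlane :=
  polar_mem_slitPlane (hρ.pos φ hφ) (Icc_half_pi_subset
    ⟨hρ.left.trans hφ.1.le, hφ.2.le.trans hρ.right⟩)

/-- The integrand of the contour integral of `f` along the curve. -/
def pullback (f : ℂ → ℂ) (ρ ρ' : ℝ → ℝ) (φ : ℝ) : ℂ :=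
  f (polar (ρ φ) φ) * ((ρ' φ + Complex.I * ρ φ) * Complex.exp (φ * Complex.I))

theorem hasDerivAt_radialPrimitive (hρ : PolarCurve ρ ρ' a b S) (hf : SlitHolomorphic f) {φ : ℝ}
    (hφ : φ ∈ Ioo a b) :
    HasDerivAt (fun φ => radialPrimitive f (polar (ρ φ) φ)) (pullback f ρ ρ' φ) φ :=
  HasDerivAt.comp (h := fun φ => polar (ρ φ) φ) φ
    (hf.hasDerivAt_radialPrimitive (hρ.mem_slitPlane hφ))
    (hasDerivAt_polar (ρ := ρ) (hρ.hasDerivAt φ hφ))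

/-- Up to sign the integrand is the derivative of `(1 + ρ)⁻¹`, which takes values in `[0, 1]`; the
sign of `ρ'` being constant, no growth control on `ρ` at the ends is needed. -/
theorem intervalIntegrable_abs_deriv (hρ : PolarCurve ρ ρ' a b S) :
    IntervalIntegrable (fun φ => |ρ' φ| / (1 + ρ φ) ^ 2) volume a b := by
  have hk : ∀ φ ∈ Ioo a b, HasDerivAt (fun φ => -(1 + ρ φ)⁻¹) (ρ' φ / (1 + ρ φ) ^ 2) φ := by
    intro φ hφ
    have := hρ.pos φ hφ
    refine (((hρ.hasDerivAt φ hφ).const_add 1).inv (by positivity)).neg.congr_deriv ?_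
    ring
  have hbd : ∀ φ ∈ Ioo a b, 0 ≤ (1 + ρ φ)⁻¹ ∧ (1 + ρ φ)⁻¹ ≤ 1 := by
    intro φ hφ
    have := hρ.pos φ hφ
    exact ⟨by positivity, inv_le_one_of_one_le₀ (by linarith)⟩
  rcases hρ.monotone with h | h
  · refine intervalIntegrable_of_hasDerivAt_of_nonneg (m := -1) (M := 0) hρ.lt (fun φ hφ =>
      (hk φ hφ).congr_deriv ?_) (fun φ hφ => by positivity) (fun φ hφ => ?_) (fun φ hφ => ?_)
    · rw [abs_of_nonneg (h φ hφ)]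
    · linarith [(hbd φ hφ).2]
    · linarith [(hbd φ hφ).1]
  · refine intervalIntegrable_of_hasDerivAt_of_nonneg (m := 0) (M := 1) hρ.lt (fun φ hφ =>
      (hk φ hφ).neg.congr_deriv ?_) (fun φ hφ => by positivity) (fun φ hφ => ?_) (fun φ hφ => ?_)
    · rw [abs_of_nonpos (h φ hφ), neg_div]
    · simpa using (hbd φ hφ).1
    · simpa using (hbd φ hφ).2

theorem intervalIntegrable (hρ : PolarCurve ρ ρ' a b S) (hf : SectorDecay f S) :
    IntervalIntegrable (pullback f ρ ρ') volume a b := by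
  obtain ⟨R₁, hR₁⟩ := hρ.large
  obtain ⟨C, hC0, hC⟩ := hf.exists_bound R₁
  have hint : IntervalIntegrable (fun φ => C * (|ρ' φ| / (1 + ρ φ) ^ 2 + 1)) volume a b :=
    (hρ.intervalIntegrable_abs_deriv.add intervalIntegrable_const).const_mul C
  have hG := fun φ hφ => hρ.hasDerivAt_radialPrimitive hf.toSlitHolomorphic (φ := φ) hφ
  rw [intervalIntegrable_iff_integrableOn_Ioo_of_le hρ.lt.le] at hint ⊢
  refine Integrable.mono' hint ?_ ?_
  -- Measurability is free: the pulled-back integrand is a derivative on the interval.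
  · have hm : AEStronglyMeasurable (deriv fun φ => radialPrimitive f (polar (ρ φ) φ))
        (volume.restrict (Ioo a b)) := (stronglyMeasurable_deriv _).aestronglyMeasurable
    refine hm.congr ((ae_restrict_iff' measurableSet_Ioo).2 (Eventually.of_forall fun φ hφ => ?_))
    exact (hG φ hφ).deriv
  · refine (ae_restrict_iff' measurableSet_Ioo).2 (Eventually.of_forall fun φ hφ => ?_)
    have hpos := hρ.pos φ hφ
    have h1 := hC (ρ φ) hpos φ (Icc_half_pi_subset
      ⟨hρ.left.trans hφ.1.le, hφ.2.le.trans hρ.right⟩) (hR₁ φ hφ)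
    have h2 : ‖((ρ' φ : ℂ) + Complex.I * ρ φ) * Complex.exp (φ * Complex.I)‖ ≤
        |ρ' φ| + (1 + ρ φ) ^ 2 := by
      rw [norm_mul, Complex.norm_exp_ofReal_mul_I, mul_one]
      refine (norm_add_le _ _).trans ?_
      rw [norm_mul, Complex.norm_I, Complex.norm_real, Complex.norm_real, one_mul,
        Real.norm_of_nonneg hpos.le, Real.norm_eq_abs]
      nlinarith
    rw [pullback, norm_mul]
    calc _ ≤ C / (1 + ρ φ) ^ 2 * (|ρ' φ| + (1 + ρ φ) ^ 2) := by gcongr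
      _ = _ := by field_simp

theorem integral_pullback (hρ : PolarCurve ρ ρ' a b S) (hf : SectorDecay f S) {A B : ℂ}
    (hA : Tendsto (fun φ => radialPrimitive f (polar (ρ φ) φ)) (𝓝[>] a) (𝓝 A))
    (hB : Tendsto (fun φ => radialPrimitive f (polar (ρ φ) φ)) (𝓝[<] b) (𝓝 B)) :
    ∫ φ in a..b, pullback f ρ ρ' φ = B - A :=
  intervalIntegral.integral_eq_sub_of_hasDerivAt_of_tendsto hρ.lt
    (fun _ hφ => hρ.hasDerivAt_radialPrimitive hf.toSlitHolomorphic hφ)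
    (hρ.intervalIntegrable hf) hA hB

theorem tendsto_of_tendsto_zero (hρ : PolarCurve ρ ρ' a b S) (hf : SlitHolomorphic f)
    {l : Filter ℝ} (hl : ∀ᶠ φ in l, φ ∈ Ioo a b) (h : Tendsto ρ l (𝓝 0)) :
    Tendsto (fun φ => radialPrimitive f (polar (ρ φ) φ)) l (𝓝 0) := by
  refine hf.tendsto_radialPrimitive_zero ?_ (hl.mono fun φ hφ => hρ.mem_slitPlane hφ)
  rw [tendsto_zero_iff_norm_tendsto_zero]
  refine h.congr' (hl.mono fun φ hφ => ?_)
  exact (norm_polar (hρ.pos φ hφ).le φ).symm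

theorem tendsto_of_tendsto_pos (hf : SlitHolomorphic f) {τ c : ℝ} (hτ : 0 < τ)
    (hc : c ∈ Ioo (-Real.pi) Real.pi) {s : Set ℝ} (h : Tendsto ρ (𝓝[s] c) (𝓝 τ)) :
    Tendsto (fun φ => radialPrimitive f (polar (ρ φ) φ)) (𝓝[s] c)
      (𝓝 (radialPrimitive f (polar τ c))) := by
  have h1 := (hf.hasDerivAt_radialPrimitive (polar_mem_slitPlane hτ hc)).continuousAt.tendsto
  refine h1.comp ((continuous_polar.tendsto (τ, c)).comp (h.prodMk_nhds ?_))
  exact tendsto_id.mono_left nhdsWithin_le_nhds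

theorem tendsto_of_tendsto_atTop (hρ : PolarCurve ρ ρ' a b S) (hf : SectorDecay f S)
    {l : Filter ℝ} (hl : ∀ᶠ φ in l, φ ∈ Ioo a b) (h : Tendsto ρ l atTop) :
    Tendsto (fun φ => radialPrimitive f (polar (ρ φ) φ)) l (𝓝 (∫ t in Ioi (0 : ℝ), f t)) := by
  obtain ⟨R₁, hR₁⟩ := hρ.large
  refine hf.tendsto_radialPrimitive h ?_
  filter_upwards [hl, h.eventually_gt_atTop R₁] with φ hφ hφ' using hR₁ φ hφ hφ'

/-- When `ρ` increases, a radius larger than `ρ p` forces an angle beyond `p`, so only the last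
stretch of the curve has to lie in the sector of decay. -/
theorem of_nonneg {p : ℝ} (hab : a < b) (ha : -(Real.pi / 2) ≤ a) (hb : b ≤ Real.pi / 2)
    (hpos : ∀ φ ∈ Ioo a b, 0 < ρ φ) (hderiv : ∀ φ ∈ Ioo a b, HasDerivAt ρ (ρ' φ) φ)
    (hnonneg : ∀ φ ∈ Ioo a b, 0 ≤ ρ' φ) (hp : p ∈ Ioo a b) (hS : Ioo p b ⊆ S) :
    PolarCurve ρ ρ' a b S := by
  refine ⟨hab, ha, hb, hpos, hderiv, Or.inl hnonneg, ρ p, fun φ hφ hlt => ?_⟩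
  refine hS ⟨lt_of_not_ge fun hle => hlt.not_ge ?_, hφ.2⟩
  refine monotoneOn_of_hasDerivWithinAt_nonneg (f' := ρ') (convex_Ioo a b)
    (fun t ht => (hderiv t ht).continuousAt.continuousWithinAt) ?_ ?_ hφ hp hle
  · intro t ht
    rw [interior_Ioo] at ht ⊢
    exact (hderiv t ht).hasDerivWithinAt
  · intro t ht
    rw [interior_Ioo] at ht
    exact hnonneg t ht

theorem of_nonpos {p : ℝ} (hab : a < b) (ha : -(Real.pi / 2) ≤ a) (hb : b ≤ Real.pi / 2)
    (hpos : ∀ φ ∈ Ioo a b, 0 < ρ φ) (hderiv : ∀ φ ∈ Ioo a b, HasDerivAt ρ (ρ' φ) φ)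
    (hnonpos : ∀ φ ∈ Ioo a b, ρ' φ ≤ 0) (hp : p ∈ Ioo a b) (hS : Ioo a p ⊆ S) :
    PolarCurve ρ ρ' a b S := by
  refine ⟨hab, ha, hb, hpos, hderiv, Or.inr hnonpos, ρ p, fun φ hφ hlt => ?_⟩
  refine hS ⟨hφ.1, lt_of_not_ge fun hle => hlt.not_ge ?_⟩
  refine antitoneOn_of_hasDerivWithinAt_nonpos (f' := ρ') (convex_Ioo a b)
    (fun t ht => (hderiv t ht).continuousAt.continuousWithinAt) ?_ ?_ hp hφ hle
  · intro t ht
    rw [interior_Ioo] at ht ⊢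
    exact (hderiv t ht).hasDerivWithinAt
  · intro t ht
    rw [interior_Ioo] at ht
    exact hnonpos t ht

end PolarCurve

end StableDensity

/-! ### The complex integrand, and `V` and `W` as parts of a contour integral. -/

namespace StableDensity

open Filter Topology

/-- The integrand of `h^n` as a function of a complex variable. -/
def hComplex (n : ℕ) (x α β : ℝ) (z : ℂ) : ℂ :=
  (Complex.I * z) ^ n * Complex.exp (Complex.I * z * x + psi z α (-β))

theorem I_mul_polar (ρ φ : ℝ) :
    Complex.I * polar ρ φ = ρ * Complex.exp ((φ + Real.pi / 2 : ℝ) * Complex.I) := by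
  push_cast
  rw [polar, add_mul, Complex.exp_add, Complex.exp_pi_div_two_mul_I]
  ring

theorem norm_hComplex_polar {n : ℕ} {x α β ρ φ E F : ℝ} (hρ : 0 ≤ ρ)
    (h : hComplex n x α β (polar ρ φ) =
      (Complex.I * polar ρ φ) ^ n * Complex.exp (E + F * Complex.I)) :
    ‖hComplex n x α β (polar ρ φ)‖ = ρ ^ n * Real.exp E := by
  rw [h, norm_mul, norm_pow, norm_mul, Complex.norm_I, one_mul, norm_polar hρ, Complex.norm_exp]
  simp

theorem exists_polar {w : ℂ} (hw : w ∈ Complex.slitPlane) :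
    ∃ ρ φ : ℝ, 0 < ρ ∧ φ ∈ Ioo (-Real.pi) Real.pi ∧ w = polar ρ φ :=
  ⟨‖w‖, w.arg, norm_pos_iff.2 (Complex.slitPlane_ne_zero hw), ⟨Complex.neg_pi_lt_arg w,
    lt_of_le_of_ne (Complex.arg_le_pi w) (Complex.mem_slitPlane_iff_arg.1 hw).1⟩,
    (Complex.norm_mul_exp_arg_mul_I w).symm⟩

theorem log_polar {ρ φ : ℝ} (hρ : 0 < ρ) (hφ : φ ∈ Ioo (-Real.pi) Real.pi) :
    Complex.log (polar ρ φ) = Real.log ρ + φ * Complex.I := by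
  rw [polar, Complex.log_ofReal_mul hρ (Complex.exp_ne_zero _), Complex.log_exp]
  · simpa using hφ.1
  · simpa using hφ.2.le

theorem polar_eq (ρ φ : ℝ) :
    polar ρ φ = ρ * Real.cos φ + ρ * Real.sin φ * Complex.I := by
  rw [polar, Complex.exp_mul_I]
  push_cast
  ring

/-- Where the exponent is real on the curve, the real and imaginary parts of the contour integrand
are the functions `V` and `W` times the exponential. -/
theorem pullback_hComplex {n : ℕ} {x α β φ w : ℝ} {ρ ρ' : ℝ → ℝ}
    (h : hComplex n x α β (polar (ρ φ) φ) = (Complex.I * polar (ρ φ) φ) ^ n * w) :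
    PolarCurve.pullback (hComplex n x α β) ρ ρ' φ =
      (w * (ρ φ ^ n * (ρ' φ * Real.sin ((n + 1) * (φ + Real.pi / 2)) +
        ρ φ * Real.cos ((n + 1) * (φ + Real.pi / 2)))) : ℝ) +
      (w * (ρ φ ^ n * (ρ φ * Real.sin ((n + 1) * (φ + Real.pi / 2)) -
        ρ' φ * Real.cos ((n + 1) * (φ + Real.pi / 2)))) : ℝ) * Complex.I := by
  have h1 : Complex.exp ((φ + Real.pi / 2 : ℝ) * Complex.I) ^ (n + 1) =
      Real.cos ((n + 1) * (φ + Real.pi / 2)) +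
        Real.sin ((n + 1) * (φ + Real.pi / 2)) * Complex.I := by
    rw [← Complex.exp_nat_mul, Complex.ofReal_cos, Complex.ofReal_sin, ← Complex.exp_mul_I]
    congr 1
    push_cast
    ring
  -- Absorbing `i` into the angle turns `(ρ' + iρ) e^{iφ}` into `(ρ - iρ') e^{i(φ + π/2)}`, which
  -- joins the factor `(iz)^n`.
  have h2 : Complex.exp (φ * Complex.I) =
      -Complex.I * Complex.exp ((φ + Real.pi / 2 : ℝ) * Complex.I) := by
    push_cast
    rw [add_mul, Complex.exp_add, Complex.exp_pi_div_two_mul_I]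
    linear_combination Complex.exp (φ * Complex.I) * Complex.I_sq
  have h3 : PolarCurve.pullback (hComplex n x α β) ρ ρ' φ =
      w * ρ φ ^ n * (ρ φ - ρ' φ * Complex.I) *
        Complex.exp ((φ + Real.pi / 2 : ℝ) * Complex.I) ^ (n + 1) := by
    rw [PolarCurve.pullback, h, I_mul_polar, h2, mul_pow, pow_succ]
    linear_combination (-(w * ρ φ ^ n * ρ φ *
      Complex.exp ((φ + Real.pi / 2 : ℝ) * Complex.I) ^ n *
        Complex.exp ((φ + Real.pi / 2 : ℝ) * Complex.I))) * Complex.I_sq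
  rw [h3, h1]
  push_cast
  linear_combination (-(w * ρ φ ^ n * ρ' φ *
    Complex.sin ((n + 1) * (φ + Real.pi / 2)))) * Complex.I_sq

/-- The integrals of `V` and `W` against the weight `w` as real and imaginary parts of a contour
integral. -/
theorem integral_V_W {n : ℕ} {x α β c : ℝ} {S : Set ℝ} {w : ℝ → ℝ} {A B : ℂ}
    (hρ : PolarCurve (r x α β) (deriv (r x α β)) (Real.pi / 2 * c) (Real.pi / 2) S)
    (hf : SectorDecay (hComplex n x α β) S)
    (hw : ∀ u ∈ Ioo c 1, hComplex n x α β (polar (r x α β (Real.pi / 2 * u)) (Real.pi / 2 * u)) =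
      (Complex.I * polar (r x α β (Real.pi / 2 * u)) (Real.pi / 2 * u)) ^ n * w u)
    (hA : Tendsto (fun φ => radialPrimitive (hComplex n x α β) (polar (r x α β φ) φ))
      (𝓝[>] (Real.pi / 2 * c)) (𝓝 A))
    (hB : Tendsto (fun φ => radialPrimitive (hComplex n x α β) (polar (r x α β φ) φ))
      (𝓝[<] (Real.pi / 2)) (𝓝 B)) :
    IntervalIntegrable (fun φ => w φ * V n x α β φ) volume c 1 ∧
    IntervalIntegrable (fun φ => w φ * W n x α β φ) volume c 1 ∧
    ∫ φ in c..1, w φ * V n x α β φ = 2 / Real.pi * (B - A).re ∧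
    ∫ φ in c..1, w φ * W n x α β φ = 2 / Real.pi * (B - A).im := by
  have hpi := Real.pi_pos
  have hc1 : c < 1 := by
    have := hρ.lt
    by_contra! hcon
    nlinarith
  set P := PolarCurve.pullback (hComplex n x α β) (r x α β) (deriv (r x α β)) with hP
  have hint : IntervalIntegrable (fun u => P (Real.pi / 2 * u)) volume c 1 := by
    have := (hρ.intervalIntegrable hf).comp_mul_left (c := Real.pi / 2)
    rwa [mul_div_cancel_left₀ _ (by positivity), div_self (by positivity)] at this
  -- The factor `2/π` comes from the substitution `φ = πu/2`; with the `1/π` in `h` it yields the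
  -- coefficient `1/2`.
  have hval : ∫ u in c..1, P (Real.pi / 2 * u) = ((2 / Real.pi : ℝ) : ℂ) * (B - A) := by
    rw [intervalIntegral.integral_comp_mul_left P (by positivity : Real.pi / 2 ≠ 0), mul_one,
      hρ.integral_pullback hf hA hB, Complex.real_smul, inv_div]
  have hpt : ∀ u ∈ Ioo c 1, P (Real.pi / 2 * u) =
      (w u * V n x α β u : ℝ) + (w u * W n x α β u : ℝ) * Complex.I := by
    intro u hu
    have hang : (n + 1) * (Real.pi / 2 * u + Real.pi / 2) = Real.pi / 2 * (n + 1) * (u + 1) := by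
      ring
    rw [hP, pullback_hComplex (hw u hu), V, W, hang]
  have hae : ∀ {g g' : ℝ → ℝ}, (∀ u ∈ Ioo c 1, g u = g' u) →
      g =ᵐ[volume.restrict (uIoc c 1)] g' := by
    intro g g' h
    rw [uIoc_of_le hc1.le, ← restrict_Ioo_eq_restrict_Ioc]
    exact (ae_restrict_iff' measurableSet_Ioo).2 (Eventually.of_forall h)
  have hre : (fun u => (P (Real.pi / 2 * u)).re) =ᵐ[volume.restrict (uIoc c 1)]
      fun u => w u * V n x α β u := hae fun u hu => by rw [hpt u hu]; simp [-Complex.ofReal_mul]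
  have him : (fun u => (P (Real.pi / 2 * u)).im) =ᵐ[volume.restrict (uIoc c 1)]
      fun u => w u * W n x α β u := hae fun u hu => by rw [hpt u hu]; simp [-Complex.ofReal_mul]
  have hre_int : IntervalIntegrable (fun u => (P (Real.pi / 2 * u)).re) volume c 1 :=
    ⟨hint.1.re, hint.2.re⟩
  have him_int : IntervalIntegrable (fun u => (P (Real.pi / 2 * u)).im) volume c 1 :=
    ⟨hint.1.im, hint.2.im⟩
  refine ⟨hre_int.congr_ae hre, him_int.congr_ae him, ?_, ?_⟩
  · rw [← intervalIntegral.integral_congr_ae_restrict hre]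
    have := Complex.reCLM.intervalIntegral_comp_comm hint
    simp only [Complex.reCLM_apply] at this
    rw [this, hval, Complex.re_ofReal_mul]
  · rw [← intervalIntegral.integral_congr_ae_restrict him]
    have := Complex.imCLM.intervalIntegral_comp_comm hint
    simp only [Complex.imCLM_apply] at this
    rw [this, hval, Complex.im_ofReal_mul]

/-- One term `y^k / k!` of the exponential series at `y = c R^γ` beats `R^(n+2)` as soon as `kγ ≥ n
+ 2`; the factor `4` is from `(1 + R)² ≤ 4R²` for `R ≥ 1`. -/
theorem exists_pow_mul_exp_neg_le (n : ℕ) {c γ : ℝ} (hc : 0 < c) (hγ : 0 < γ) :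
    ∃ C R₀ : ℝ, ∀ R ≥ R₀, R ^ n * Real.exp (-(c * R ^ γ)) ≤ C / (1 + R) ^ 2 := by
  obtain ⟨k, hk⟩ := exists_nat_ge ((n + 2) / γ)
  rw [div_le_iff₀ hγ] at hk
  refine ⟨4 * (k.factorial / c ^ k), 1, fun R hR => ?_⟩
  have hR0 : 0 < R := by linarith
  have h1 := Real.pow_div_factorial_le_exp (c * R ^ γ) (by positivity) k
  have h2 : R ^ (n + 2) ≤ (R ^ γ) ^ k := by
    rw [← Real.rpow_natCast, ← Real.rpow_natCast, ← Real.rpow_mul hR0.le]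
    refine Real.rpow_le_rpow_of_exponent_le hR ?_
    push_cast
    linarith
  rw [Real.exp_neg, le_div_iff₀ (by positivity), ← div_eq_mul_inv, div_mul_eq_mul_div,
    div_le_iff₀ (Real.exp_pos _)]
  have h3 : (1 + R) ^ 2 ≤ 4 * R ^ 2 := by nlinarith
  calc R ^ n * (1 + R) ^ 2 ≤ R ^ n * (4 * R ^ 2) := by gcongr
    _ = 4 * R ^ (n + 2) := by ring
    _ ≤ 4 * (R ^ γ) ^ k := by gcongr
    _ = 4 * (k.factorial / c ^ k) * ((c * R ^ γ) ^ k / k.factorial) := by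
        rw [mul_pow]
        field_simp
    _ ≤ _ := by gcongr

end StableDensity

/-! ### The case `α ≠ 1`: growth and decay of the integrand. -/

namespace StableDensity

open Filter Topology

/-- The left end of the interval of angles. -/
def leftAngle (α β : ℝ) : ℝ := Real.pi / 2 * -theta α β

/-- The constant rotation in `ψ` merges with the argument of `z^α`, so that `β` enters only through
a shift of the angle by `leftAngle α β`. -/
theorem hComplex_polar {n : ℕ} {x α β ρ φ : ℝ} (hα : α ≠ 1) (hρ : 0 < ρ)
    (hφ : φ ∈ Ioo (-Real.pi) Real.pi) :
    hComplex n x α β (polar ρ φ) = (Complex.I * polar ρ φ) ^ n * Complex.exp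
      ((-(x * ρ * Real.sin φ) - ρ ^ α * Real.cos (α * (φ - leftAngle α β)) : ℝ) +
        (x * ρ * Real.cos φ - ρ ^ α * Real.sin (α * (φ - leftAngle α β)) : ℝ) * Complex.I) := by
  have htheta : theta α (-β) = -theta α β := by
    unfold theta
    ring
  have hne : polar ρ φ ≠ 0 := Complex.slitPlane_ne_zero (polar_mem_slitPlane hρ hφ)
  have hpow : polar ρ φ ^ (α : ℂ) = (ρ ^ α : ℝ) * Complex.exp ((α * φ : ℝ) * Complex.I) := by
    rw [Complex.cpow_def_of_ne_zero hne, log_polar hρ hφ, add_mul, Complex.exp_add,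
      Real.rpow_def_of_pos hρ]
    push_cast
    ring_nf
  have hrot : polar ρ φ ^ (α : ℂ) * Complex.exp (-Complex.I *
      ((Real.pi / 2 * theta α (-β) * α : ℝ) : ℂ)) =
      (ρ ^ α : ℝ) * (Real.cos (α * (φ - leftAngle α β)) +
        Real.sin (α * (φ - leftAngle α β)) * Complex.I) := by
    rw [hpow, htheta, mul_assoc, ← Complex.exp_add, Complex.ofReal_cos, Complex.ofReal_sin,
      ← Complex.exp_mul_I]
    congr 2
    rw [leftAngle]
    push_cast
    ring
  rw [hComplex, psi, if_neg hα, neg_mul, hrot, polar_eq]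
  congr 2
  push_cast
  linear_combination (x * ρ * Complex.sin φ) * Complex.I_sq

theorem norm_hComplex {n : ℕ} {x α β ρ φ : ℝ} (hα : α ≠ 1) (hρ : 0 < ρ)
    (hφ : φ ∈ Ioo (-Real.pi) Real.pi) :
    ‖hComplex n x α β (polar ρ φ)‖ = ρ ^ n *
      Real.exp (-(x * ρ * Real.sin φ) - ρ ^ α * Real.cos (α * (φ - leftAngle α β))) :=
  norm_hComplex_polar hρ.le (hComplex_polar hα hρ hφ)

theorem slitHolomorphic_hComplex (n : ℕ) (x β : ℝ) {α : ℝ} (hα : α ≠ 1) (hα0 : 0 < α) :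
    SlitHolomorphic (hComplex n x α β) := by
  refine ⟨?_, fun M => ⟨M ^ n * Real.exp (|x| * M + M ^ α), fun w hw hwM => ?_⟩⟩
  · intro z hz
    unfold hComplex psi
    simp only [if_neg hα]
    refine DifferentiableAt.differentiableWithinAt ?_
    have : DifferentiableAt ℂ (fun z : ℂ => z ^ (α : ℂ)) z := differentiableAt_id.cpow_const hz
    fun_prop
  · obtain ⟨ρ, φ, hρ, hφ, rfl⟩ := exists_polar hw
    rw [norm_polar hρ.le] at hwM
    rw [norm_hComplex hα hρ hφ]
    have h1 : -(x * ρ * Real.sin φ) ≤ |x| * M := by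
      calc _ ≤ |x * ρ * Real.sin φ| := neg_le_abs _
        _ = |x| * ρ * |Real.sin φ| := by rw [abs_mul, abs_mul, abs_of_pos hρ]
        _ ≤ |x| * ρ * 1 := by gcongr; exact Real.abs_sin_le_one φ
        _ ≤ |x| * M := by rw [mul_one]; gcongr
    have h2 : -(ρ ^ α * Real.cos (α * (φ - leftAngle α β))) ≤ M ^ α := by
      have h3 : ρ ^ α ≤ M ^ α := Real.rpow_le_rpow hρ.le hwM hα0.le
      have h4 := Real.neg_one_le_cos (α * (φ - leftAngle α β))
      nlinarith [Real.rpow_pos_of_pos hρ α]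
    have hM : 0 ≤ M := hρ.le.trans hwM
    gcongr
    linarith

/-- Exponential decay in the first quadrant, for `α < 1`. -/
theorem sectorDecay_of_lt_one (n : ℕ) {x α β : ℝ} (hα0 : 0 < α) (hα1 : α < 1) (hx : 0 < x)
    (ha : |leftAngle α β| ≤ Real.pi / 2) :
    SectorDecay (hComplex n x α β) (Icc 0 (Real.pi / 2)) := by
  have hpi := Real.pi_pos
  refine ⟨slitHolomorphic_hComplex n x β hα1.ne hα0, convex_Icc _ _,
    ⟨le_rfl, by positivity⟩, Icc_subset_Icc (by linarith) le_rfl, ?_⟩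
  set c := Real.cos (α * (Real.pi / 2)) with hc
  have hcpos : 0 < c := Real.cos_pos_of_mem_Ioo ⟨by nlinarith, by nlinarith⟩
  obtain ⟨C, R₀, hC⟩ := exists_pow_mul_exp_neg_le n (c := c ^ 2) (by positivity) hα0
  have hlarge : ∀ᶠ R : ℝ in atTop, Real.pi / (2 * x) ≤ R ^ (1 - α) :=
    (tendsto_rpow_atTop (by linarith)).eventually_ge_atTop _
  obtain ⟨R₁, hR₁⟩ := eventually_atTop.1 hlarge
  refine ⟨C, max 1 (max R₀ R₁), fun R hR η hη => ?_⟩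
  have hR1 : 0 < R := by linarith [(le_max_left _ _).trans hR]
  have hR2 : R₀ ≤ R := ((le_max_left _ _).trans (le_max_right _ _)).trans hR
  have hR3 : R₁ ≤ R := ((le_max_right _ _).trans (le_max_right _ _)).trans hR
  refine le_trans ?_ (hC R hR2)
  rw [norm_hComplex hα1.ne hR1 (Icc_half_pi_subset ⟨by linarith [hη.1], hη.2⟩)]
  gcongr
  -- The cosine can be negative near `η = π/2`. Its possible deficit `sin(αη)` is at most `(π/2) sin
  -- η` by Jordan's inequality, and is paid for by the term `-x R sin η`, since `xR ≥ (π/2) R^α` for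
  -- large `R`.
  have hcos : c ^ 2 - Real.sin (α * η) ≤ Real.cos (α * (η - leftAngle α β)) := by
    rw [mul_sub, Real.cos_sub]
    have h1 : c ≤ Real.cos (α * η) :=
      Real.cos_le_cos_of_nonneg_of_le_pi (mul_nonneg hα0.le hη.1) (by nlinarith)
        (mul_le_mul_of_nonneg_left hη.2 hα0.le)
    have h2 : c ≤ Real.cos (α * leftAngle α β) := by
      rw [← Real.cos_abs (α * leftAngle α β), abs_mul, abs_of_pos hα0]
      exact Real.cos_le_cos_of_nonneg_of_le_pi (by positivity) (by nlinarith)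
        (mul_le_mul_of_nonneg_left ha hα0.le)
    have h3 : 0 ≤ Real.sin (α * η) := Real.sin_nonneg_of_nonneg_of_le_pi
      (mul_nonneg hα0.le hη.1) (by nlinarith [hη.1, hη.2])
    have h4 := Real.neg_one_le_sin (α * leftAngle α β)
    nlinarith
  have hsin : Real.sin (α * η) ≤ Real.pi / 2 * Real.sin η := by
    have h1 := Real.mul_le_sin hη.1 hη.2
    have h2 := Real.sin_le (mul_nonneg hα0.le hη.1)
    have h3 : α * η ≤ η := mul_le_of_le_one_left hη.1 hα1.le
    have h4 : Real.pi / 2 * (2 / Real.pi * η) ≤ Real.pi / 2 * Real.sin η := by gcongr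
    have h5 : Real.pi / 2 * (2 / Real.pi * η) = η := by field_simp
    linarith
  have hRα : 0 < R ^ α := Real.rpow_pos_of_pos hR1 α
  have hxR : Real.pi / 2 * R ^ α ≤ x * R := by
    have h1 := hR₁ R hR3
    rw [div_le_iff₀ (by positivity)] at h1
    have h2 : R ^ (1 - α) * R ^ α = R := by
      rw [← Real.rpow_add hR1, sub_add_cancel, Real.rpow_one]
    nlinarith
  have hs : 0 ≤ Real.sin η :=
    Real.sin_nonneg_of_nonneg_of_le_pi hη.1 (by linarith [hη.2])
  nlinarith [mul_le_mul_of_nonneg_right hxR hs, mul_le_mul_of_nonneg_left hcos hRα.le,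
    mul_le_mul_of_nonneg_left hsin hRα.le]

/-- The half-width of the sector of decay for `α > 1`. -/
def sectorAngle (α : ℝ) : ℝ := Real.pi * (2 - α) / (2 * α)

theorem sectorAngle_pos {α : ℝ} (hα1 : 1 < α) (hα2 : α < 2) : 0 < sectorAngle α :=
  div_pos (mul_pos Real.pi_pos (by linarith)) (by linarith)

theorem mul_sectorAngle {α : ℝ} (hα1 : 1 < α) : α * sectorAngle α = Real.pi / 2 * (2 - α) := by
  unfold sectorAngle
  have : α ≠ 0 := by linarith
  field_simp

theorem sectorAngle_lt {α : ℝ} (hα1 : 1 < α) : sectorAngle α < Real.pi / 2 := by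
  have h := mul_sectorAngle hα1
  have hpi := Real.pi_pos
  by_contra! hcon
  nlinarith

/-- The set of angles at distance at most `sectorAngle α` from `a`, in the right half-plane. -/
def sector (α a : ℝ) : Set ℝ :=
  Icc (a - sectorAngle α) (a + sectorAngle α) ∩ Icc (-(Real.pi / 2)) (Real.pi / 2)

/-- Exponential decay in a sector around the left end of the curve, for `1 < α < 2`. -/
theorem sectorDecay_of_one_lt (n : ℕ) {x α β : ℝ} (hα1 : 1 < α) (hα2 : α < 2) (hx : 0 < x)
    (ha : |leftAngle α β| ≤ sectorAngle α) :
    SectorDecay (hComplex n x α β) (sector α (leftAngle α β)) := by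
  have hpi := Real.pi_pos
  have hα0 : 0 < α := by linarith
  rw [abs_le] at ha
  refine ⟨slitHolomorphic_hComplex n x β hα1.ne' hα0, (convex_Icc _ _).inter (convex_Icc _ _),
    ⟨⟨by linarith, by linarith⟩, ⟨by linarith, by linarith⟩⟩, inter_subset_right, ?_⟩
  set c := Real.cos (α * sectorAngle α) with hc
  have hcpos : 0 < c := by
    rw [hc, mul_sectorAngle hα1]
    exact Real.cos_pos_of_mem_Ioo ⟨by nlinarith, by nlinarith⟩
  obtain ⟨C, R₀, hC⟩ := exists_pow_mul_exp_neg_le n (c := c / 2) (by positivity) hα0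
  have hlarge : ∀ᶠ R : ℝ in atTop, 2 * x / c ≤ R ^ (α - 1) :=
    (tendsto_rpow_atTop (by linarith)).eventually_ge_atTop _
  obtain ⟨R₁, hR₁⟩ := eventually_atTop.1 hlarge
  refine ⟨C, max 1 (max R₀ R₁), fun R hR η hη => ?_⟩
  have hR1 : 0 < R := by linarith [(le_max_left _ _).trans hR]
  have hR2 : R₀ ≤ R := ((le_max_left _ _).trans (le_max_right _ _)).trans hR
  have hR3 : R₁ ≤ R := ((le_max_right _ _).trans (le_max_right _ _)).trans hR
  refine le_trans ?_ (hC R hR2)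
  rw [norm_hComplex hα1.ne' hR1 (Icc_half_pi_subset hη.2)]
  gcongr
  have hcos : c ≤ Real.cos (α * (η - leftAngle α β)) := by
    rw [← Real.cos_abs (α * (η - leftAngle α β)), abs_mul, abs_of_pos hα0]
    refine Real.cos_le_cos_of_nonneg_of_le_pi (by positivity) ?_ ?_
    · rw [mul_sectorAngle hα1]
      nlinarith
    · gcongr
      exact abs_le.2 ⟨by linarith [hη.1.1], by linarith [hη.1.2]⟩
  have hRα : 0 < R ^ α := Real.rpow_pos_of_pos hR1 α
  -- For `α > 1` the linear term is the lower-order one: it costs at most half of the decay `c R^α`.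
  have hxR : x * R ≤ c / 2 * R ^ α := by
    have h1 := hR₁ R hR3
    rw [div_le_iff₀ (by positivity)] at h1
    have h2 : R ^ (α - 1) * R = R ^ α := by
      rw [← Real.rpow_add_one hR1.ne', sub_add_cancel]
    nlinarith
  have hs := Real.neg_one_le_sin η
  nlinarith [mul_le_mul_of_nonneg_left hcos hRα.le, mul_pos hx hR1]

/-! ### The case `α ≠ 1`: monotonicity and end behaviour of the curve. -/

/-- The base of the power that defines `r`, in terms of the left end `a` of the angles. -/
def ratio (x α a φ : ℝ) : ℝ := Real.sin (α * (φ - a)) / (x * Real.cos φ)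

theorem r_eq_ratio {x α β : ℝ} (hα : α ≠ 1) (φ : ℝ) :
    r x α β φ = ratio x α (leftAngle α β) φ ^ (1 / (1 - α)) := by
  rw [r, if_neg hα, ratio, leftAngle]
  congr 4
  ring

variable {x α a φ : ℝ}

theorem sin_pos_of_angle (hα0 : 0 < α) (hend : α * (Real.pi / 2 - a) ≤ Real.pi)
    (hφ : φ ∈ Ioo a (Real.pi / 2)) : 0 < Real.sin (α * (φ - a)) := by
  refine Real.sin_pos_of_pos_of_lt_pi (mul_pos hα0 (by linarith [hφ.1])) ?_
  refine lt_of_lt_of_le ?_ hend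
  gcongr
  exact hφ.2

theorem cos_pos_of_angle (ha : -(Real.pi / 2) ≤ a) (hφ : φ ∈ Ioo a (Real.pi / 2)) :
    0 < Real.cos φ :=
  Real.cos_pos_of_mem_Ioo ⟨ha.trans_lt hφ.1, hφ.2⟩

theorem ratio_pos (hα0 : 0 < α) (hx : 0 < x) (ha : -(Real.pi / 2) ≤ a)
    (hend : α * (Real.pi / 2 - a) ≤ Real.pi) (hφ : φ ∈ Ioo a (Real.pi / 2)) :
    0 < ratio x α a φ :=
  div_pos (sin_pos_of_angle hα0 hend hφ) (mul_pos hx (cos_pos_of_angle ha hφ))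

/-- The numerator of the derivative of `ratio`. -/
def ratioNumerator (α a φ : ℝ) : ℝ :=
  α * Real.cos (α * (φ - a)) * Real.cos φ + Real.sin (α * (φ - a)) * Real.sin φ

theorem hasDerivAt_ratio (hx : 0 < x) (hcos : 0 < Real.cos φ) :
    HasDerivAt (ratio x α a) (ratioNumerator α a φ / (x * Real.cos φ ^ 2)) φ := by
  have h1 : HasDerivAt (fun φ => α * (φ - a)) α φ := by
    simpa using ((hasDerivAt_id φ).sub_const a).const_mul α
  refine (h1.sin.div ((Real.hasDerivAt_cos φ).const_mul x) (by positivity)).congr_deriv ?_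
  rw [ratioNumerator]
  field_simp
  ring

theorem hasDerivAt_ratioNumerator (α a φ : ℝ) : HasDerivAt (ratioNumerator α a)
    ((1 - α ^ 2) * (Real.cos φ * Real.sin (α * (φ - a)))) φ := by
  have h1 : HasDerivAt (fun φ => α * (φ - a)) α φ := by
    simpa using ((hasDerivAt_id φ).sub_const a).const_mul α
  refine (((h1.cos.const_mul α).mul (Real.hasDerivAt_cos φ)).add
    (h1.sin.mul (Real.hasDerivAt_sin φ))).congr_deriv ?_
  ring

/-- The derivative of the numerator has the sign of `1 - α²`, so its infimum is an end value: `α cos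
a` at `a` if `α ≤ 1`, and `sin(α(π/2 - a))` at `π/2` if `α ≥ 1`. Both are nonnegative. -/
theorem ratioNumerator_nonneg (hα0 : 0 < α) (ha : -(Real.pi / 2) ≤ a)
    (hend : α * (Real.pi / 2 - a) ≤ Real.pi) (hφ : φ ∈ Ioo a (Real.pi / 2)) :
    0 ≤ ratioNumerator α a φ := by
  have hlt : a < Real.pi / 2 := hφ.1.trans hφ.2
  have hcont : ContinuousOn (ratioNumerator α a) (Icc a (Real.pi / 2)) := fun t _ =>
    (hasDerivAt_ratioNumerator α a t).continuousAt.continuousWithinAt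
  have hderiv : ∀ t ∈ interior (Icc a (Real.pi / 2)), HasDerivWithinAt (ratioNumerator α a)
      ((1 - α ^ 2) * (Real.cos t * Real.sin (α * (t - a)))) (interior (Icc a (Real.pi / 2))) t :=
    fun t _ => (hasDerivAt_ratioNumerator α a t).hasDerivWithinAt
  have hprod : ∀ t ∈ interior (Icc a (Real.pi / 2)),
      0 ≤ Real.cos t * Real.sin (α * (t - a)) := by
    intro t ht
    rw [interior_Icc] at ht
    exact mul_nonneg (cos_pos_of_angle ha ht).le (sin_pos_of_angle hα0 hend ht).le
  rcases le_total α 1 with hα | hα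
  · have hmono := monotoneOn_of_hasDerivWithinAt_nonneg (convex_Icc _ _) hcont hderiv
      (fun t ht => mul_nonneg (by nlinarith) (hprod t ht))
    refine le_trans ?_ (hmono (left_mem_Icc.2 hlt.le) (Ioo_subset_Icc_self hφ) hφ.1.le)
    simp only [ratioNumerator, sub_self, mul_zero, Real.cos_zero, Real.sin_zero, mul_one,
      zero_mul, add_zero]
    exact mul_nonneg hα0.le (Real.cos_nonneg_of_mem_Icc ⟨ha, hlt.le⟩)
  · have hanti := antitoneOn_of_hasDerivWithinAt_nonpos (convex_Icc _ _) hcont hderiv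
      (fun t ht => mul_nonpos_of_nonpos_of_nonneg (by nlinarith) (hprod t ht))
    refine le_trans ?_ (hanti (Ioo_subset_Icc_self hφ) (right_mem_Icc.2 hlt.le) hφ.2.le)
    simp only [ratioNumerator, Real.cos_pi_div_two, Real.sin_pi_div_two, mul_one,
      mul_zero, zero_add]
    exact Real.sin_nonneg_of_nonneg_of_le_pi (mul_nonneg hα0.le (by linarith)) hend

/-- The ratio increases for every `α`; the exponent `1/(1-α)` alone decides whether `r` increases or
decreases. -/
theorem hasDerivAt_r {β : ℝ} (hα : α ≠ 1) (hα0 : 0 < α) (hx : 0 < x)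
    (ha : -(Real.pi / 2) ≤ leftAngle α β)
    (hend : α * (Real.pi / 2 - leftAngle α β) ≤ Real.pi)
    (hφ : φ ∈ Ioo (leftAngle α β) (Real.pi / 2)) :
    ∃ d ≥ 0, HasDerivAt (r x α β) (1 / (1 - α) * d) φ := by
  have hQ := ratio_pos hα0 hx ha hend hφ
  have hcos := cos_pos_of_angle ha hφ
  have h := (hasDerivAt_ratio (α := α) (a := leftAngle α β) hx hcos).rpow_const
    (p := 1 / (1 - α)) (Or.inl hQ.ne')
  rw [← funext (r_eq_ratio (x := x) (β := β) hα)] at h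
  refine ⟨ratioNumerator α (leftAngle α β) φ / (x * Real.cos φ ^ 2) *
    ratio x α (leftAngle α β) φ ^ (1 / (1 - α) - 1), ?_, h.congr_deriv (by ring)⟩
  have := ratioNumerator_nonneg hα0 ha hend hφ
  positivity

theorem tendsto_ratio_left (ha : -(Real.pi / 2) < a) (ha' : a < Real.pi / 2) (hx : 0 < x) :
    Tendsto (ratio x α a) (𝓝 a) (𝓝 0) := by
  have hcos : 0 < Real.cos a := Real.cos_pos_of_mem_Ioo ⟨ha, ha'⟩
  have := (hasDerivAt_ratio (α := α) (a := a) hx hcos).continuousAt.tendsto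
  simpa [ratio] using this

theorem tendsto_sin_mul_div_sin (α : ℝ) (hx : x ≠ 0) :
    Tendsto (fun t => Real.sin (α * t) / (x * Real.sin t)) (𝓝[≠] 0) (𝓝 (α / x)) := by
  have h1 : HasDerivAt (fun t => Real.sin (α * t)) α 0 := by
    have h : HasDerivAt (fun t : ℝ => α * t) α 0 := by
      simpa using (hasDerivAt_id (0 : ℝ)).const_mul α
    simpa using h.sin
  have h2 : HasDerivAt (fun t => x * Real.sin t) x 0 := by
    simpa using (Real.hasDerivAt_sin 0).const_mul x
  have h3 := (hasDerivAt_iff_tendsto_slope.1 h1).div (hasDerivAt_iff_tendsto_slope.1 h2) hx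
  refine h3.congr' ?_
  filter_upwards [self_mem_nhdsWithin] with t ht
  have ht : t ≠ 0 := ht
  simp only [Pi.div_apply, slope_def_field, mul_zero, Real.sin_zero, sub_zero]
  field_simp

/-- Here sine and cosine vanish together, and the finite limit `α/x` gives `r → τ`. This is the end
behaviour for `α < 1`, `β = 1`. -/
theorem tendsto_ratio_left_neg_half_pi (hx : 0 < x) :
    Tendsto (ratio x α (-(Real.pi / 2))) (𝓝[>] (-(Real.pi / 2))) (𝓝 (α / x)) := by
  have hshift : Tendsto (fun φ => φ + Real.pi / 2) (𝓝[>] (-(Real.pi / 2))) (𝓝[≠] 0) := by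
    refine tendsto_nhdsWithin_of_tendsto_nhds_of_eventually_within _ ?_ ?_
    · have : Tendsto (fun φ => φ + Real.pi / 2) (𝓝 (-(Real.pi / 2)))
        (𝓝 (-(Real.pi / 2) + Real.pi / 2)) := Continuous.tendsto (by fun_prop) _
      rw [neg_add_cancel] at this
      exact this.mono_left nhdsWithin_le_nhds
    · filter_upwards [self_mem_nhdsWithin] with φ hφ
      have : -(Real.pi / 2) < φ := hφ
      exact (by linarith : (0 : ℝ) < φ + Real.pi / 2).ne'
  refine ((tendsto_sin_mul_div_sin α hx.ne').comp hshift).congr fun φ => ?_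
  rw [Function.comp_apply, ratio, Real.sin_add_pi_div_two, sub_neg_eq_add]

theorem tendsto_ratio_right (hα0 : 0 < α) (hx : 0 < x) (ha : a < Real.pi / 2)
    (hend : α * (Real.pi / 2 - a) < Real.pi) :
    Tendsto (ratio x α a) (𝓝[<] (Real.pi / 2)) atTop := by
  have hpi := Real.pi_pos
  have hsin : 0 < Real.sin (α * (Real.pi / 2 - a)) :=
    Real.sin_pos_of_pos_of_lt_pi (mul_pos hα0 (by linarith)) hend
  have h1 : Tendsto (fun φ => Real.sin (α * (φ - a))) (𝓝[<] (Real.pi / 2))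
      (𝓝 (Real.sin (α * (Real.pi / 2 - a)))) :=
    (Continuous.tendsto (by fun_prop) _).mono_left nhdsWithin_le_nhds
  have h2 : Tendsto (fun φ => x * Real.cos φ) (𝓝[<] (Real.pi / 2)) (𝓝[>] 0) := by
    refine tendsto_nhdsWithin_of_tendsto_nhds_of_eventually_within _ ?_ ?_
    · have : Tendsto (fun φ => x * Real.cos φ) (𝓝 (Real.pi / 2))
        (𝓝 (x * Real.cos (Real.pi / 2))) := Continuous.tendsto (by fun_prop) _
      rw [Real.cos_pi_div_two, mul_zero] at this
      exact this.mono_left nhdsWithin_le_nhds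
    · filter_upwards [Ioo_mem_nhdsLT (by linarith : -(Real.pi / 2) < Real.pi / 2)] with φ hφ
      exact mul_pos hx (Real.cos_pos_of_mem_Ioo hφ)
  exact (Tendsto.pos_mul_atTop hsin h1 (tendsto_inv_nhdsGT_zero.comp h2)).congr fun φ => by
    simp [ratio, div_eq_mul_inv]

/-- The other `0/0` end, which occurs for `α > 1`, `β = -1`; reflecting the sine about `π` reduces
it to the same quotient. -/
theorem tendsto_ratio_right_of_eq (hx : 0 < x) (hend : α * (Real.pi / 2 - a) = Real.pi) :
    Tendsto (ratio x α a) (𝓝[<] (Real.pi / 2)) (𝓝 (α / x)) := by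
  have hshift : Tendsto (fun φ => Real.pi / 2 - φ) (𝓝[<] (Real.pi / 2)) (𝓝[≠] 0) := by
    refine tendsto_nhdsWithin_of_tendsto_nhds_of_eventually_within _ ?_ ?_
    · have : Tendsto (fun φ => Real.pi / 2 - φ) (𝓝 (Real.pi / 2))
        (𝓝 (Real.pi / 2 - Real.pi / 2)) := Continuous.tendsto (by fun_prop) _
      rw [sub_self] at this
      exact this.mono_left nhdsWithin_le_nhds
    · filter_upwards [self_mem_nhdsWithin] with φ hφ
      have : φ < Real.pi / 2 := hφ
      exact (by linarith : (0 : ℝ) < Real.pi / 2 - φ).ne'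
  refine ((tendsto_sin_mul_div_sin α hx.ne').comp hshift).congr fun φ => ?_
  have hangle : α * (Real.pi / 2 - φ) = Real.pi - α * (φ - a) := by linarith
  rw [Function.comp_apply, ratio, Real.sin_pi_div_two_sub, hangle, Real.sin_pi_sub]

end StableDensity

/-! ### The case `α ≠ 1`: evaluation of the contour integral. -/

namespace StableDensity

open Filter Topology

variable {n : ℕ} {x α β φ : ℝ}

theorem r_pos (hα : α ≠ 1) (hα0 : 0 < α) (hx : 0 < x) (ha : -(Real.pi / 2) ≤ leftAngle α β)
    (hend : α * (Real.pi / 2 - leftAngle α β) ≤ Real.pi)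
    (hφ : φ ∈ Ioo (leftAngle α β) (Real.pi / 2)) : 0 < r x α β φ := by
  rw [r_eq_ratio hα]
  exact Real.rpow_pos_of_pos (ratio_pos hα0 hx ha hend hφ) _

/-- On the curve the exponent is real, and the integrand is given by the weight. -/
theorem hComplex_curve (hα : α ≠ 1) (hα0 : 0 < α) (hx : 0 < x)
    (ha : -(Real.pi / 2) ≤ leftAngle α β)
    (hend : α * (Real.pi / 2 - leftAngle α β) ≤ Real.pi) {u : ℝ} (hu : u ∈ Ioo (-theta α β) 1) :
    hComplex n x α β (polar (r x α β (Real.pi / 2 * u)) (Real.pi / 2 * u)) =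
      (Complex.I * polar (r x α β (Real.pi / 2 * u)) (Real.pi / 2 * u)) ^ n *
        weight x α β u := by
  have hpi := Real.pi_pos
  set φ := Real.pi / 2 * u with hφdef
  have hφ : φ ∈ Ioo (leftAngle α β) (Real.pi / 2) := by
    refine ⟨?_, by nlinarith [hu.2]⟩
    rw [leftAngle, hφdef]
    gcongr
    exact hu.1
  have hQ := ratio_pos hα0 hx ha hend hφ
  have hcos := cos_pos_of_angle ha hφ
  have hsin := sin_pos_of_angle hα0 hend hφ
  have hρ := r_pos hα hα0 hx ha hend hφ
  have hα' : 1 - α ≠ 0 := sub_ne_zero.2 hα.symm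
  set ρ := r x α β φ with hρdef
  have hQρ : ρ = ratio x α (leftAngle α β) φ ^ (1 / (1 - α)) := r_eq_ratio hα φ
  have hpow1 : ρ ^ (1 - α) = ratio x α (leftAngle α β) φ := by
    rw [hQρ, ← Real.rpow_mul hQ.le, one_div, inv_mul_cancel₀ hα', Real.rpow_one]
  have hsplit : ρ = ρ ^ α * ratio x α (leftAngle α β) φ := by
    rw [← hpow1, ← Real.rpow_add hρ, add_sub_cancel, Real.rpow_one]
  have hxρ : x * ρ * Real.cos φ = ρ ^ α * Real.sin (α * (φ - leftAngle α β)) := by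
    have h : ratio x α (leftAngle α β) φ * (x * Real.cos φ) =
        Real.sin (α * (φ - leftAngle α β)) := by
      rw [ratio]
      field_simp
    calc x * ρ * Real.cos φ = ρ * (x * Real.cos φ) := by ring
      _ = ρ ^ α * (ratio x α (leftAngle α β) φ * (x * Real.cos φ)) := by
          conv_lhs => rw [hsplit]
          ring
      _ = _ := by rw [h]
  have hpowα : ρ ^ α = x ^ (α / (α - 1)) *
      (Real.sin (α * (φ - leftAngle α β)) / Real.cos φ) ^ (α / (1 - α)) := by
    have h1 : ratio x α (leftAngle α β) φ =
        x⁻¹ * (Real.sin (α * (φ - leftAngle α β)) / Real.cos φ) := by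
      rw [ratio]
      field_simp
    have h2 : x ^ (α / (α - 1)) = x⁻¹ ^ (α / (1 - α)) := by
      rw [Real.inv_rpow hx.le, ← Real.rpow_neg hx.le]
      congr 1
      rw [← div_neg, neg_sub]
    rw [hQρ, ← Real.rpow_mul hQ.le, h1, h2, ← Real.mul_rpow (by positivity) (by positivity)]
    congr 1
    ring
  have hphase : Real.cos (α * (φ - leftAngle α β) - φ) =
      Real.cos (α * (φ - leftAngle α β)) * Real.cos φ +
        Real.sin (α * (φ - leftAngle α β)) * Real.sin φ := Real.cos_sub _ _
  -- Replacing `xρ` by `ρ^α sin(α(φ - a)) / cos φ`, with `a` the left angle, turns the real part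
  -- into `-ρ^α cos(α(φ - a) - φ) / cos φ`, by the subtraction formula.
  have hexp : -(x * ρ * Real.sin φ) - ρ ^ α * Real.cos (α * (φ - leftAngle α β)) =
      -(x ^ (α / (α - 1)) * U α u (theta α β)) := by
    have ha1 : Real.pi / 2 * α * (u + theta α β) = α * (φ - leftAngle α β) := by
      rw [hφdef, leftAngle]
      ring
    have ha2 : Real.pi / 2 * ((α - 1) * u + α * theta α β) = α * (φ - leftAngle α β) - φ := by
      rw [hφdef, leftAngle]
      ring
    rw [U, ha1, ha2, ← hφdef, ← mul_assoc, ← hpowα, hphase]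
    field_simp
    linear_combination (-Real.sin φ) * hxρ
  rw [hComplex_polar hα hρ (Icc_half_pi_subset ⟨ha.trans hφ.1.le, hφ.2.le⟩), hxρ, sub_self, hexp]
  simp [weight]

theorem leftAngle_of_lt_one (hα0 : 0 < α) (hα1 : α < 1) :
    leftAngle α β = -(Real.pi / 2 * β) := by
  rw [leftAngle, theta, K, Real.sign_of_pos (by linarith)]
  field_simp
  ring

theorem leftAngle_of_one_lt (hα1 : 1 < α) : leftAngle α β = β * sectorAngle α := by
  have : α ≠ 0 := by linarith
  rw [leftAngle, theta, K, Real.sign_of_neg (by linarith), sectorAngle]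
  field_simp
  ring

theorem polarCurve_of_lt_one (hα0 : 0 < α) (hα1 : α < 1) (hx : 0 < x) (hβ0 : -1 < β)
    (hβ1 : β ≤ 1) :
    PolarCurve (r x α β) (deriv (r x α β)) (leftAngle α β) (Real.pi / 2)
      (Icc 0 (Real.pi / 2)) := by
  have hpi := Real.pi_pos
  have ha := leftAngle_of_lt_one (β := β) hα0 hα1
  have ha1 : -(Real.pi / 2) ≤ leftAngle α β := by rw [ha]; nlinarith
  have ha2 : leftAngle α β < Real.pi / 2 := by rw [ha]; nlinarith
  have hend : α * (Real.pi / 2 - leftAngle α β) ≤ Real.pi := by nlinarith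
  -- The midpoint keeps `p` strictly inside the interval, and the maximum with `0` puts all later
  -- angles in the first quadrant.
  refine PolarCurve.of_nonneg (p := max 0 ((leftAngle α β + Real.pi / 2) / 2)) ha2 ha1 le_rfl
    (fun φ hφ => r_pos hα1.ne hα0 hx ha1 hend hφ) ?_ ?_ ⟨?_, ?_⟩ ?_
  · intro φ hφ
    obtain ⟨d, -, hd⟩ := hasDerivAt_r hα1.ne hα0 hx ha1 hend hφ
    exact hd.differentiableAt.hasDerivAt
  · intro φ hφ
    obtain ⟨d, hd0, hd⟩ := hasDerivAt_r hα1.ne hα0 hx ha1 hend hφ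
    rw [hd.deriv]
    exact mul_nonneg (one_div_nonneg.2 (by linarith)) hd0
  · exact lt_max_of_lt_right (by linarith)
  · exact max_lt (by linarith) (by linarith)
  · exact fun φ hφ => ⟨(le_max_left _ _).trans hφ.1.le, hφ.2.le⟩

theorem polarCurve_of_one_lt (hα1 : 1 < α) (hα2 : α < 2) (hx : 0 < x) (hβ0 : -1 ≤ β)
    (hβ1 : β ≤ 1) :
    PolarCurve (r x α β) (deriv (r x α β)) (leftAngle α β) (Real.pi / 2)
      (sector α (leftAngle α β)) := by
  have hpi := Real.pi_pos
  have hα0 : 0 < α := by linarith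
  have ha := leftAngle_of_one_lt (β := β) hα1
  have hs0 := sectorAngle_pos hα1 hα2
  have hs1 := sectorAngle_lt hα1
  have hs2 := mul_sectorAngle hα1
  have ha0 : -sectorAngle α ≤ leftAngle α β := by rw [ha]; nlinarith
  have ha1 : -(Real.pi / 2) ≤ leftAngle α β := by linarith
  have ha2 : leftAngle α β < Real.pi / 2 := by rw [ha]; nlinarith
  have hend : α * (Real.pi / 2 - leftAngle α β) ≤ Real.pi := by nlinarith
  refine PolarCurve.of_nonpos (p := min (leftAngle α β + sectorAngle α)
    ((leftAngle α β + Real.pi / 2) / 2)) ha2 ha1 le_rfl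
    (fun φ hφ => r_pos hα1.ne' hα0 hx ha1 hend hφ) ?_ ?_ ⟨?_, ?_⟩ ?_
  · intro φ hφ
    obtain ⟨d, -, hd⟩ := hasDerivAt_r hα1.ne' hα0 hx ha1 hend hφ
    exact hd.differentiableAt.hasDerivAt
  · intro φ hφ
    obtain ⟨d, hd0, hd⟩ := hasDerivAt_r hα1.ne' hα0 hx ha1 hend hφ
    rw [hd.deriv]
    exact mul_nonpos_of_nonpos_of_nonneg (one_div_nonpos.2 (by linarith)) hd0
  · exact lt_min (by linarith) (by linarith)
  · exact min_lt_of_right_lt (by linarith)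
  · intro φ hφ
    have h1 := hφ.2.le.trans (min_le_left _ _)
    have h2 := hφ.2.le.trans (min_le_right _ _)
    exact ⟨⟨by linarith [hφ.1], h1⟩, ⟨by linarith [hφ.1], by linarith⟩⟩

theorem tendsto_r {l : Filter ℝ} {y : ℝ} (hα : α ≠ 1) (hy : 0 < y)
    (h : Tendsto (ratio x α (leftAngle α β)) l (𝓝 y)) :
    Tendsto (r x α β) l (𝓝 (y ^ (1 / (1 - α)))) := by
  rw [funext (r_eq_ratio (x := x) (β := β) hα)]
  exact h.rpow_const (Or.inl hy.ne')

/-- `h` as an integral of `hComplex` over the positive half-axis. -/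
theorem h_eq (n : ℕ) (x α β : ℝ) :
    h n x α β = ((1 / Real.pi : ℝ) : ℂ) * ∫ t in Ioi (0 : ℝ), hComplex n x α β t := rfl

theorem eventually_mem_Ioo_left {a b : ℝ} (hab : a < b) : ∀ᶠ φ in 𝓝[>] a, φ ∈ Ioo a b :=
  Ioo_mem_nhdsGT hab

theorem eventually_mem_Ioo_right {a b : ℝ} (hab : a < b) : ∀ᶠ φ in 𝓝[<] b, φ ∈ Ioo a b :=
  Ioo_mem_nhdsLT hab

/-- The contour formulas for `α < 1`, `β > -1`, where `A` is the value of the primitive at the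
initial point of the curve. -/
theorem contour_of_lt_one (hα0 : 0 < α) (hα1 : α < 1) (hx : 0 < x) (hβ0 : -1 < β)
    (hβ1 : β ≤ 1) {A : ℂ}
    (hA : Tendsto (fun φ => radialPrimitive (hComplex n x α β) (polar (r x α β φ) φ))
      (𝓝[>] (leftAngle α β)) (𝓝 A)) :
    IntervalIntegrable (fun φ => weight x α β φ * V n x α β φ) volume (-theta α β) 1 ∧
    IntervalIntegrable (fun φ => weight x α β φ * W n x α β φ) volume (-theta α β) 1 ∧
    (h n x α β).re = 1 / 2 * (∫ φ in (-theta α β)..1, weight x α β φ * V n x α β φ) +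
      1 / Real.pi * A.re ∧
    (h n x α β).im = 1 / 2 * (∫ φ in (-theta α β)..1, weight x α β φ * W n x α β φ) +
      1 / Real.pi * A.im := by
  have hpi := Real.pi_pos
  have ha := leftAngle_of_lt_one (β := β) hα0 hα1
  have ha1 : |leftAngle α β| ≤ Real.pi / 2 := by
    rw [ha, abs_le]
    constructor <;> nlinarith
  have hend : α * (Real.pi / 2 - leftAngle α β) < Real.pi := by
    nlinarith [mul_le_mul_of_nonneg_left (neg_le_of_abs_le ha1) hα0.le]
  have hcurve := polarCurve_of_lt_one hα0 hα1 hx hβ0 hβ1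
  have hdecay := sectorDecay_of_lt_one n hα0 hα1 hx ha1
  have hr : Tendsto (r x α β) (𝓝[<] (Real.pi / 2)) atTop := by
    rw [funext (r_eq_ratio (x := x) (β := β) hα1.ne)]
    exact (tendsto_rpow_atTop (one_div_pos.2 (by linarith))).comp
      (tendsto_ratio_right hα0 hx hcurve.lt hend)
  obtain ⟨h1, h2, h3, h4⟩ := integral_V_W hcurve hdecay
    (fun u hu => hComplex_curve hα1.ne hα0 hx (abs_le.1 ha1).1 hend.le hu) hA
    (hcurve.tendsto_of_tendsto_atTop hdecay (eventually_mem_Ioo_right hcurve.lt) hr)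
  refine ⟨h1, h2, ?_, ?_⟩
  · rw [h3, h_eq, Complex.re_ofReal_mul, Complex.sub_re]
    field_simp
    ring
  · rw [h4, h_eq, Complex.im_ofReal_mul, Complex.sub_im]
    field_simp
    ring

/-- The contour formulas for `α > 1`, where `B` is the value of the primitive at the final point of
the curve. -/
theorem contour_of_one_lt (hα1 : 1 < α) (hα2 : α < 2) (hx : 0 < x) (hβ0 : -1 ≤ β)
    (hβ1 : β ≤ 1) {B : ℂ}
    (hB : Tendsto (fun φ => radialPrimitive (hComplex n x α β) (polar (r x α β φ) φ))
      (𝓝[<] (Real.pi / 2)) (𝓝 B)) :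
    IntervalIntegrable (fun φ => weight x α β φ * V n x α β φ) volume (-theta α β) 1 ∧
    IntervalIntegrable (fun φ => weight x α β φ * W n x α β φ) volume (-theta α β) 1 ∧
    (h n x α β).re = -1 / 2 * (∫ φ in (-theta α β)..1, weight x α β φ * V n x α β φ) +
      1 / Real.pi * B.re ∧
    (h n x α β).im = -1 / 2 * (∫ φ in (-theta α β)..1, weight x α β φ * W n x α β φ) +
      1 / Real.pi * B.im := by
  have hpi := Real.pi_pos
  have hα0 : 0 < α := by linarith
  have ha := leftAngle_of_one_lt (β := β) hα1
  have hs0 := sectorAngle_pos hα1 hα2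
  have hs1 := sectorAngle_lt hα1
  have hs2 := mul_sectorAngle hα1
  have ha1 : |leftAngle α β| ≤ sectorAngle α := by
    rw [ha, abs_le]
    constructor <;> nlinarith
  have ha2 := (abs_le.1 ha1).1
  have hend : α * (Real.pi / 2 - leftAngle α β) ≤ Real.pi := by nlinarith
  have hcurve := polarCurve_of_one_lt hα1 hα2 hx hβ0 hβ1
  have hdecay := sectorDecay_of_one_lt n hα1 hα2 hx ha1
  -- The approach to `0` through positive values matters: the exponent `1/(1-α)` is negative, so `r`
  -- tends to infinity.
  have hratio : Tendsto (ratio x α (leftAngle α β)) (𝓝[>] leftAngle α β) (𝓝[>] 0) := by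
    refine tendsto_nhdsWithin_of_tendsto_nhds_of_eventually_within _
      ((tendsto_ratio_left (by linarith) hcurve.lt hx).mono_left nhdsWithin_le_nhds) ?_
    filter_upwards [eventually_mem_Ioo_left hcurve.lt] with φ hφ
    exact ratio_pos hα0 hx hcurve.left hend hφ
  have hr : Tendsto (r x α β) (𝓝[>] leftAngle α β) atTop := by
    rw [funext (r_eq_ratio (x := x) (β := β) hα1.ne')]
    exact (tendsto_rpow_neg_nhdsGT_zero (one_div_neg.2 (by linarith))).comp hratio
  obtain ⟨h1, h2, h3, h4⟩ := integral_V_W hcurve hdecay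
    (fun u hu => hComplex_curve hα1.ne' hα0 hx hcurve.left hend hu)
    (hcurve.tendsto_of_tendsto_atTop hdecay (eventually_mem_Ioo_left hcurve.lt) hr) hB
  refine ⟨h1, h2, ?_, ?_⟩
  · rw [h3, h_eq, Complex.re_ofReal_mul, Complex.sub_re]
    field_simp
    ring
  · rw [h4, h_eq, Complex.im_ofReal_mul, Complex.sub_im]
    field_simp
    ring

/-- The value of the primitive at the end of a segment on which the integrand is real. -/
theorem radialPrimitive_polar {f : ℂ → ℂ} {g : ℝ → ℝ} {φ R : ℝ} (hR : 0 < R)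
    (hg : ∀ s ∈ Ioc 0 R, f (polar s φ) = g s) :
    radialPrimitive f (polar R φ) =
      Complex.exp (φ * Complex.I) * (∫ s in (0 : ℝ)..R, g s : ℝ) := by
  rw [polar, SlitHolomorphic.radialPrimitive_ofReal_mul f hR, ← intervalIntegral.integral_ofReal]
  congr 1
  refine intervalIntegral.integral_congr_ae (Eventually.of_forall fun s hs => ?_)
  rw [uIoc_of_le hR.le] at hs
  exact hg s hs

theorem exp_half_pi_mul_I : Complex.exp ((Real.pi / 2 : ℝ) * Complex.I) = Complex.I := by
  push_cast
  exact Complex.exp_pi_div_two_mul_I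

theorem exp_neg_half_pi_mul_I :
    Complex.exp ((-(Real.pi / 2) : ℝ) * Complex.I) = -Complex.I := by
  push_cast
  rw [neg_mul, Complex.exp_neg, Complex.exp_pi_div_two_mul_I, Complex.inv_I]

theorem I_mul_polar_half_pi (s : ℝ) : Complex.I * polar s (Real.pi / 2) = (-s : ℝ) := by
  rw [polar, exp_half_pi_mul_I]
  push_cast
  linear_combination (s : ℂ) * Complex.I_sq

theorem I_mul_polar_neg_half_pi (s : ℝ) : Complex.I * polar s (-(Real.pi / 2)) = s := by
  rw [polar, exp_neg_half_pi_mul_I]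
  linear_combination (-(s : ℂ)) * Complex.I_sq

theorem half_pi_mem : Real.pi / 2 ∈ Ioo (-Real.pi) Real.pi :=
  Icc_half_pi_subset ⟨by linarith [Real.pi_pos], le_rfl⟩

theorem neg_half_pi_mem : -(Real.pi / 2) ∈ Ioo (-Real.pi) Real.pi :=
  Icc_half_pi_subset ⟨le_rfl, by linarith [Real.pi_pos]⟩

/-- On the positive imaginary axis the integrand is real if the sine of the angle vanishes there. -/
theorem hComplex_half_pi (hα : α ≠ 1)
    (hsin : Real.sin (α * (Real.pi / 2 - leftAngle α β)) = 0) {s : ℝ} (hs : 0 < s) :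
    hComplex n x α β (polar s (Real.pi / 2)) = ((-s) ^ n *
      Real.exp (-(x * s) - s ^ α * Real.cos (α * (Real.pi / 2 - leftAngle α β))) : ℝ) := by
  rw [hComplex_polar hα hs half_pi_mem, I_mul_polar_half_pi, hsin]
  simp

/-- A real integrand on a segment of direction `i` has a purely imaginary contour integral. This
serves both `β = -1` cases: the limit at infinity for `α < 1` and the endpoint `iτ` for `α > 1`. -/
theorem radialPrimitive_half_pi_re (hα : α ≠ 1)
    (hsin : Real.sin (α * (Real.pi / 2 - leftAngle α β)) = 0) {R : ℝ} (hR : 0 < R) :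
    (radialPrimitive (hComplex n x α β) (polar R (Real.pi / 2))).re = 0 := by
  rw [radialPrimitive_polar hR fun s hs => hComplex_half_pi hα hsin hs.1, exp_half_pi_mul_I,
    Complex.I_mul_re, Complex.ofReal_im, neg_zero]

/-- For `α < 1`, `β = -1` the contour is the positive imaginary axis. -/
theorem h_re_of_lt_one_of_eq_neg_one (hα0 : 0 < α) (hα1 : α < 1) (hx : 0 < x) :
    (h n x α (-1)).re = 0 := by
  have hpi := Real.pi_pos
  have ha : leftAngle α (-1) = Real.pi / 2 := by
    rw [leftAngle_of_lt_one hα0 hα1]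
    ring
  have hdecay := sectorDecay_of_lt_one n hα0 hα1 hx (β := -1)
    (by rw [ha, abs_of_pos (by positivity)])
  have hlim := hdecay.tendsto_radialPrimitive (φ := fun _ => Real.pi / 2) tendsto_id
    (Eventually.of_forall fun _ => ⟨by positivity, le_rfl⟩)
  have hre := (Complex.continuous_re.tendsto _).comp hlim
  have hzero : Tendsto (fun _ : ℝ => (0 : ℝ)) atTop (𝓝 0) := tendsto_const_nhds
  rw [h_eq, Complex.re_ofReal_mul, tendsto_nhds_unique (hre.congr' ?_) hzero, mul_zero]
  filter_upwards [eventually_gt_atTop 0] with R hR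
  exact radialPrimitive_half_pi_re hα1.ne (by simp [ha]) hR

theorem tau_pos (hα0 : 0 < α) (hx : 0 < x) (hα : α ≠ 1) : 0 < tau x α := by
  rw [tau, if_neg hα]
  positivity

/-- The value of the primitive at the initial point of the curve for `α < 1`, `β = 1`. -/
theorem radialPrimitive_neg_half_pi (hα0 : 0 < α) (hα1 : α < 1) (hx : 0 < x) :
    radialPrimitive (hComplex n x α 1) (polar (tau x α) (-(Real.pi / 2))) =
      -Complex.I * (∫ s in (0 : ℝ)..tau x α, Real.exp (x * s - s ^ α) * s ^ n : ℝ) := by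
  have ha : leftAngle α 1 = -(Real.pi / 2) := by
    rw [leftAngle_of_lt_one hα0 hα1]
    ring
  rw [radialPrimitive_polar (tau_pos hα0 hx hα1.ne) fun s hs => ?_, exp_neg_half_pi_mul_I]
  rw [hComplex_polar hα1.ne hs.1 neg_half_pi_mem, I_mul_polar_neg_half_pi, ha]
  simp [mul_comm]

/-- The curve starts at the origin if `β < 1` and at `-iτ` if `β = 1`. -/
theorem main_of_lt_one (n : ℕ) (hα0 : 0 < α) (hα1 : α < 1) (hx : 0 < x) (hβ0 : -1 < β)
    (hβ1 : β ≤ 1) :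
    IntervalIntegrable (fun φ => weight x α β φ * V n x α β φ) volume (-theta α β) 1 ∧
    IntervalIntegrable (fun φ => weight x α β φ * W n x α β φ) volume (-theta α β) 1 ∧
    (h n x α β).re = 1 / 2 * (∫ φ in (-theta α β)..1, weight x α β φ * V n x α β φ) ∧
    (β ≠ 1 → (h n x α β).im =
      1 / 2 * (∫ φ in (-theta α β)..1, weight x α β φ * W n x α β φ)) ∧
    (β = 1 → (h n x α β).im =
      1 / 2 * (∫ φ in (-theta α β)..1, weight x α β φ * W n x α β φ) -
        1 / Real.pi * ∫ s in (0 : ℝ)..tau x α, Real.exp (x * s - s ^ α) * s ^ n) := by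
  have hpi := Real.pi_pos
  have ha := leftAngle_of_lt_one (β := β) hα0 hα1
  have hcurve := polarCurve_of_lt_one hα0 hα1 hx hβ0 hβ1
  have hslit := slitHolomorphic_hComplex n x β hα1.ne hα0
  rcases hβ1.eq_or_lt with rfl | hβ
  · have ha' : leftAngle α 1 = -(Real.pi / 2) := by rw [ha, mul_one]
    have hr : Tendsto (r x α 1) (𝓝[>] leftAngle α 1) (𝓝 (tau x α)) := by
      rw [tau, if_neg hα1.ne]
      refine tendsto_r hα1.ne (by positivity) ?_
      rw [ha']
      exact tendsto_ratio_left_neg_half_pi hx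
    have hA := PolarCurve.tendsto_of_tendsto_pos hslit (tau_pos hα0 hx hα1.ne)
      (by rw [ha']; exact neg_half_pi_mem) hr
    have hτ := radialPrimitive_neg_half_pi (n := n) hα0 hα1 hx
    rw [← ha'] at hτ
    rw [hτ] at hA
    obtain ⟨h1, h2, h3, h4⟩ := contour_of_lt_one hα0 hα1 hx hβ0 le_rfl hA
    refine ⟨h1, h2, ?_, fun hne => absurd rfl hne, fun _ => ?_⟩
    · rw [h3]
      simp
    · rw [h4]
      simp only [neg_mul, Complex.neg_im, Complex.I_mul_im, Complex.ofReal_re]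
      ring
  · have hr : Tendsto (r x α β) (𝓝[>] leftAngle α β) (𝓝 0) := by
      rw [funext (r_eq_ratio (x := x) (β := β) hα1.ne)]
      have hs : 0 < 1 / (1 - α) := one_div_pos.2 (by linarith)
      have hQ := (tendsto_ratio_left (α := α) (a := leftAngle α β) (by rw [ha]; nlinarith)
        hcurve.lt hx).mono_left (nhdsWithin_le_nhds (s := Ioi (leftAngle α β)))
      have := hQ.rpow_const (Or.inr hs.le)
      rwa [Real.zero_rpow hs.ne'] at this
    have hA := hcurve.tendsto_of_tendsto_zero hslit (eventually_mem_Ioo_left hcurve.lt) hr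
    obtain ⟨h1, h2, h3, h4⟩ := contour_of_lt_one hα0 hα1 hx hβ0 hβ1 hA
    exact ⟨h1, h2, by simpa using h3, fun _ => by simpa using h4, fun heq => absurd heq hβ.ne⟩

/-- The curve ends at the origin if `β > -1` and at `iτ` if `β = -1`, where only the real part is
free of a correction. -/
theorem main_of_one_lt (n : ℕ) (hα1 : 1 < α) (hα2 : α < 2) (hx : 0 < x) (hβ0 : -1 ≤ β)
    (hβ1 : β ≤ 1) :
    IntervalIntegrable (fun φ => weight x α β φ * V n x α β φ) volume (-theta α β) 1 ∧
    IntervalIntegrable (fun φ => weight x α β φ * W n x α β φ) volume (-theta α β) 1 ∧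
    (h n x α β).re = -1 / 2 * (∫ φ in (-theta α β)..1, weight x α β φ * V n x α β φ) ∧
    (-1 < β → (h n x α β).im =
      -1 / 2 * (∫ φ in (-theta α β)..1, weight x α β φ * W n x α β φ)) := by
  have hpi := Real.pi_pos
  have hα0 : 0 < α := by linarith
  have ha := leftAngle_of_one_lt (β := β) hα1
  have hs0 := sectorAngle_pos hα1 hα2
  have hs2 := mul_sectorAngle hα1
  have hcurve := polarCurve_of_one_lt hα1 hα2 hx hβ0 hβ1
  have hslit := slitHolomorphic_hComplex n x β hα1.ne' hα0
  rcases hβ0.eq_or_lt with rfl | hβ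
  · have hend : α * (Real.pi / 2 - leftAngle α (-1)) = Real.pi := by
      rw [ha]
      linarith
    have hr : Tendsto (r x α (-1)) (𝓝[<] (Real.pi / 2)) (𝓝 (tau x α)) := by
      rw [tau, if_neg hα1.ne']
      exact tendsto_r hα1.ne' (by positivity) (tendsto_ratio_right_of_eq hx hend)
    have hB := PolarCurve.tendsto_of_tendsto_pos hslit (tau_pos hα0 hx hα1.ne') half_pi_mem hr
    obtain ⟨h1, h2, h3, h4⟩ := contour_of_one_lt hα1 hα2 hx le_rfl hβ1 hB
    refine ⟨h1, h2, ?_, fun hlt => absurd hlt (lt_irrefl _)⟩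
    rw [h3, radialPrimitive_half_pi_re hα1.ne' (by rw [hend, Real.sin_pi])
      (tau_pos hα0 hx hα1.ne')]
    ring
  · have hend : α * (Real.pi / 2 - leftAngle α β) < Real.pi := by
      rw [ha]
      have hmul : -1 * (α * sectorAngle α) < β * (α * sectorAngle α) :=
        mul_lt_mul_of_pos_right hβ (mul_pos hα0 hs0)
      calc α * (Real.pi / 2 - β * sectorAngle α)
          = α * (Real.pi / 2) - β * (α * sectorAngle α) := by ring
        _ < α * (Real.pi / 2) + α * sectorAngle α := by linarith
        _ = Real.pi := by rw [hs2]; ring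
    have hr : Tendsto (r x α β) (𝓝[<] (Real.pi / 2)) (𝓝 0) := by
      rw [funext (r_eq_ratio (x := x) (β := β) hα1.ne')]
      have hs : 0 < 1 / (α - 1) := one_div_pos.2 (by linarith)
      have hneg : 1 / (1 - α) = -(1 / (α - 1)) := by rw [← neg_sub α 1, div_neg]
      rw [hneg]
      exact (tendsto_rpow_neg_atTop hs).comp (tendsto_ratio_right hα0 hx hcurve.lt hend)
    have hB := hcurve.tendsto_of_tendsto_zero hslit (eventually_mem_Ioo_right hcurve.lt) hr
    obtain ⟨h1, h2, h3, h4⟩ := contour_of_one_lt hα1 hα2 hx hβ0 hβ1 hB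
    exact ⟨h1, h2, by simpa using h3, fun _ => by simpa using h4⟩

end StableDensity

/-! ### The case `α = 1`. -/

namespace StableDensity

open Filter Topology

variable {n : ℕ} {x β φ : ℝ}

theorem hComplex_one_polar {ρ : ℝ} (hρ : 0 < ρ) (hφ : φ ∈ Ioo (-Real.pi) Real.pi) :
    hComplex n x 1 β (polar ρ φ) = (Complex.I * polar ρ φ) ^ n * Complex.exp
      ((-(ρ * Real.sin φ * (x + β * Real.log ρ)) - ρ * Real.cos φ * (β * φ + Real.pi / 2) : ℝ) +
        (ρ * Real.cos φ * (x + β * Real.log ρ) -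
          ρ * Real.sin φ * (β * φ + Real.pi / 2) : ℝ) * Complex.I) := by
  rw [hComplex, psi, if_pos rfl, log_polar hρ hφ, polar_eq]
  congr 2
  push_cast
  linear_combination (ρ * Complex.sin φ * (x + β * Real.log ρ) + ρ * Complex.cos φ * β * φ +
    ρ * Complex.sin φ * Complex.I * β * φ) * Complex.I_sq

theorem norm_hComplex_one {ρ : ℝ} (hρ : 0 < ρ) (hφ : φ ∈ Ioo (-Real.pi) Real.pi) :
    ‖hComplex n x 1 β (polar ρ φ)‖ = ρ ^ n * Real.exp
      (-(ρ * Real.sin φ * (x + β * Real.log ρ)) - ρ * Real.cos φ * (β * φ + Real.pi / 2)) :=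
  norm_hComplex_polar hρ.le (hComplex_one_polar hρ hφ)

theorem slitHolomorphic_hComplex_one (n : ℕ) (x β : ℝ) : SlitHolomorphic (hComplex n x 1 β) := by
  refine ⟨?_, fun M => ?_⟩
  · intro z hz
    unfold hComplex psi
    simp only [if_true]
    refine DifferentiableAt.differentiableWithinAt ?_
    have : DifferentiableAt ℂ Complex.log z := Complex.differentiableAt_log hz
    fun_prop
  -- The logarithm appears only as `ρ log ρ`, which is continuous up to `0`.
  · obtain ⟨D, hD⟩ := (isCompact_Icc (a := (0 : ℝ)) (b := M)).exists_bound_of_continuousOn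
      (Real.continuous_mul_log.continuousOn)
    refine ⟨M ^ n * Real.exp (|x| * M + |β| * D + M * (|β| * Real.pi + Real.pi / 2)),
      fun w hw hwM => ?_⟩
    obtain ⟨ρ, φ, hρ, hφ, rfl⟩ := exists_polar hw
    rw [norm_polar hρ.le] at hwM
    have hM : 0 ≤ M := hρ.le.trans hwM
    have hpi := Real.pi_pos
    rw [norm_hComplex_one hρ hφ]
    have hlog : |ρ * Real.log ρ| ≤ D := hD ρ ⟨hρ.le, hwM⟩
    have h1 : -(ρ * Real.sin φ * (x + β * Real.log ρ)) ≤ |x| * M + |β| * D := by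
      calc _ ≤ |ρ * Real.sin φ * (x + β * Real.log ρ)| := neg_le_abs _
        _ = |Real.sin φ| * |x * ρ + β * (ρ * Real.log ρ)| := by
            rw [← abs_mul]
            congr 1
            ring
        _ ≤ 1 * (|x| * ρ + |β| * |ρ * Real.log ρ|) := by
            gcongr
            · exact Real.abs_sin_le_one φ
            · refine (abs_add_le _ _).trans_eq ?_
              rw [abs_mul, abs_mul β, abs_of_pos hρ]
        _ ≤ |x| * M + |β| * D := by
            rw [one_mul]
            gcongr
    have h2 : -(ρ * Real.cos φ * (β * φ + Real.pi / 2)) ≤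
        M * (|β| * Real.pi + Real.pi / 2) := by
      calc _ ≤ |ρ * Real.cos φ * (β * φ + Real.pi / 2)| := neg_le_abs _
        _ = ρ * |Real.cos φ| * |β * φ + Real.pi / 2| := by
            rw [abs_mul, abs_mul, abs_of_pos hρ]
        _ ≤ M * 1 * (|β| * Real.pi + Real.pi / 2) := by
            gcongr
            · exact Real.abs_cos_le_one φ
            · refine (abs_add_le _ _).trans ?_
              rw [abs_mul, abs_of_pos (by positivity : 0 < Real.pi / 2)]
              gcongr
              exact abs_le.2 ⟨hφ.1.le, hφ.2.le⟩
        _ = _ := by rw [mul_one]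
    gcongr
    linarith

/-- Exponential decay in the first quadrant, for `α = 1`. -/
theorem sectorDecay_one (n : ℕ) (x : ℝ) (hβ : 0 < β) :
    SectorDecay (hComplex n x 1 β) (Icc 0 (Real.pi / 2)) := by
  have hpi := Real.pi_pos
  refine ⟨slitHolomorphic_hComplex_one n x β, convex_Icc _ _,
    ⟨le_rfl, by positivity⟩, Icc_subset_Icc (by linarith) le_rfl, ?_⟩
  obtain ⟨C, R₀, hC⟩ := exists_pow_mul_exp_neg_le n (c := 1) (γ := 1) one_pos one_pos
  have hlarge : ∀ᶠ R : ℝ in atTop, 1 ≤ x + β * Real.log R :=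
    (tendsto_atTop_add_const_left _ x
      (Real.tendsto_log_atTop.const_mul_atTop hβ)).eventually_ge_atTop _
  obtain ⟨R₁, hR₁⟩ := eventually_atTop.1 hlarge
  refine ⟨C, max 1 (max R₀ R₁), fun R hR η hη => ?_⟩
  have hR1 : 0 < R := by linarith [(le_max_left _ _).trans hR]
  have hR2 : R₀ ≤ R := ((le_max_left _ _).trans (le_max_right _ _)).trans hR
  have hR3 : R₁ ≤ R := ((le_max_right _ _).trans (le_max_right _ _)).trans hR
  refine le_trans ?_ (hC R hR2)
  rw [norm_hComplex_one hR1 (Icc_half_pi_subset ⟨by linarith [hη.1], hη.2⟩), one_mul,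
    Real.rpow_one]
  gcongr
  have hs : 0 ≤ Real.sin η :=
    Real.sin_nonneg_of_nonneg_of_le_pi hη.1 (by linarith [hη.2])
  have hc : 0 ≤ Real.cos η := Real.cos_nonneg_of_mem_Icc ⟨by linarith [hη.1], hη.2⟩
  -- For large `R` the factors `x + β log R` and `βη + π/2` are both at least `1`, so the exponent
  -- is at most `-R (sin η + cos η) ≤ -R`.
  have hsc : 1 ≤ Real.sin η + Real.cos η := by
    nlinarith [Real.sin_sq_add_cos_sq η, Real.sin_le_one η, Real.cos_le_one η]
  have h1 : 1 ≤ β * η + Real.pi / 2 := by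
    have := Real.pi_gt_three
    nlinarith [mul_nonneg hβ.le hη.1]
  have h2 := mul_le_mul_of_nonneg_left (hR₁ R hR3) (mul_nonneg hR1.le hs)
  have h3 := mul_le_mul_of_nonneg_left h1 (mul_nonneg hR1.le hc)
  nlinarith

theorem r_one (x β φ : ℝ) :
    r x 1 β φ = Real.exp (-x / β + (φ + Real.pi / (2 * β)) * Real.tan φ) := if_pos rfl

/-- On the curve the exponent is real, and the integrand is given by the weight. -/
theorem hComplex_one_curve (hβ : 0 < β) {u : ℝ} (hu : u ∈ Ioo (-1 : ℝ) 1) :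
    hComplex n x 1 β (polar (r x 1 β (Real.pi / 2 * u)) (Real.pi / 2 * u)) =
      (Complex.I * polar (r x 1 β (Real.pi / 2 * u)) (Real.pi / 2 * u)) ^ n *
        weight₁ x β u := by
  have hpi := Real.pi_pos
  set φ := Real.pi / 2 * u with hφdef
  have hφ : φ ∈ Ioo (-(Real.pi / 2)) (Real.pi / 2) :=
    ⟨by nlinarith [hu.1], by nlinarith [hu.2]⟩
  have hcos := Real.cos_pos_of_mem_Ioo hφ
  have hρ : 0 < r x 1 β φ := by
    rw [r_one]
    exact Real.exp_pos _
  have hlog : x + β * Real.log (r x 1 β φ) = (β * φ + Real.pi / 2) * Real.tan φ := by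
    rw [r_one, Real.log_exp]
    field_simp
    ring
  have htan : Real.tan φ * Real.cos φ = Real.sin φ := Real.tan_mul_cos hcos.ne'
  rw [hComplex_one_polar hρ (Icc_half_pi_subset (Ioo_subset_Icc_self hφ)), hlog]
  have him : r x 1 β φ * Real.cos φ * ((β * φ + Real.pi / 2) * Real.tan φ) -
      r x 1 β φ * Real.sin φ * (β * φ + Real.pi / 2) = 0 := by
    linear_combination (r x 1 β φ * (β * φ + Real.pi / 2)) * htan
  have hre : -(r x 1 β φ * Real.sin φ * ((β * φ + Real.pi / 2) * Real.tan φ)) -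
      r x 1 β φ * Real.cos φ * (β * φ + Real.pi / 2) =
        -(Real.exp (-x / β) * U₁ u β) := by
    have hU : Real.exp (-x / β) * U₁ u β =
        r x 1 β φ * (Real.pi / 2 * (1 + β * u) / Real.cos φ) := by
      have harg : Real.pi / 2 * (u + 1 / β) * Real.tan φ =
          (φ + Real.pi / (2 * β)) * Real.tan φ := by
        rw [hφdef]
        field_simp
      rw [U₁, ← hφdef, harg, r_one, Real.exp_add]
      ring
    have hfac : Real.pi / 2 * (1 + β * u) = β * φ + Real.pi / 2 := by
      rw [hφdef]
      ring
    rw [hU, hfac, Real.tan_eq_sin_div_cos]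
    field_simp
    linear_combination (-(β * Real.pi * u + Real.pi)) * Real.sin_sq_add_cos_sq φ
  rw [him, hre]
  simp [weight₁]

/-- The sign is that of `sin φ cos φ + φ + π/(2β)`. Since `β ≤ 1`, twice this is at least `sin 2φ +
2(φ + π/2)`, which is `t - sin t ≥ 0` with `t = 2(φ + π/2)`. -/
theorem hasDerivAt_r_one (hβ : 0 < β) (hβ1 : β ≤ 1)
    (hφ : φ ∈ Ioo (-(Real.pi / 2)) (Real.pi / 2)) :
    ∃ d ≥ 0, HasDerivAt (r x 1 β) d φ := by
  have hcos := Real.cos_pos_of_mem_Ioo hφ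
  have h1 : HasDerivAt (fun φ => -x / β + (φ + Real.pi / (2 * β)) * Real.tan φ)
      (1 * Real.tan φ + (φ + Real.pi / (2 * β)) * (1 / Real.cos φ ^ 2)) φ :=
    (((hasDerivAt_id φ).add_const _).mul (Real.hasDerivAt_tan hcos.ne')).const_add _
  have h2 := h1.exp
  rw [← funext (r_one x β)] at h2
  refine ⟨_, mul_nonneg (Real.exp_pos _).le ?_, h2⟩
  have hnum : 0 ≤ Real.sin φ * Real.cos φ + (φ + Real.pi / (2 * β)) := by
    have h3 : Real.pi / 2 ≤ Real.pi / (2 * β) := by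
      have := Real.pi_pos
      gcongr
      linarith
    have h4 : -(2 * (φ + Real.pi / 2)) ≤ Real.sin (2 * φ) := by
      have h5 : Real.sin (2 * φ) = -Real.sin (2 * (φ + Real.pi / 2)) := by
        rw [← Real.sin_add_pi]
        have : 2 * (φ + Real.pi / 2) + Real.pi = 2 * φ + 2 * Real.pi := by ring
        rw [this, Real.sin_add_two_pi]
      have := Real.sin_le (x := 2 * (φ + Real.pi / 2)) (by linarith [hφ.1])
      linarith
    rw [Real.sin_two_mul] at h4
    linarith
  have : 1 * Real.tan φ + (φ + Real.pi / (2 * β)) * (1 / Real.cos φ ^ 2) =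
      (Real.sin φ * Real.cos φ + (φ + Real.pi / (2 * β))) / Real.cos φ ^ 2 := by
    rw [Real.tan_eq_sin_div_cos]
    field_simp
  rw [this]
  positivity

theorem polarCurve_one (x : ℝ) (hβ : 0 < β) (hβ1 : β ≤ 1) :
    PolarCurve (r x 1 β) (deriv (r x 1 β)) (Real.pi / 2 * -1) (Real.pi / 2)
      (Icc 0 (Real.pi / 2)) := by
  have hpi := Real.pi_pos
  rw [mul_neg_one]
  refine PolarCurve.of_nonneg (p := 0) (by linarith) le_rfl le_rfl ?_ ?_ ?_
    ⟨by linarith, by linarith⟩ Ioo_subset_Icc_self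
  · intro φ _
    rw [r_one]
    exact Real.exp_pos _
  · intro φ hφ
    obtain ⟨d, -, hd⟩ := hasDerivAt_r_one (x := x) hβ hβ1 hφ
    exact hd.differentiableAt.hasDerivAt
  · intro φ hφ
    obtain ⟨d, hd0, hd⟩ := hasDerivAt_r_one (x := x) hβ hβ1 hφ
    rwa [hd.deriv]

theorem tendsto_r_one_right (x : ℝ) (hβ : 0 < β) :
    Tendsto (r x 1 β) (𝓝[<] (Real.pi / 2)) atTop := by
  have hpi := Real.pi_pos
  rw [funext (r_one x β)]
  refine Real.tendsto_exp_atTop.comp (tendsto_atTop_add_const_left _ _ ?_)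
  refine Tendsto.pos_mul_atTop (C := Real.pi / 2 + Real.pi / (2 * β)) (by positivity) ?_
    Real.tendsto_tan_pi_div_two
  exact (Continuous.tendsto (by fun_prop) _).mono_left nhdsWithin_le_nhds

theorem tendsto_r_one_left (x : ℝ) (hβ : 0 < β) (hβ1 : β < 1) :
    Tendsto (r x 1 β) (𝓝[>] (-(Real.pi / 2))) (𝓝 0) := by
  have hpi := Real.pi_pos
  rw [funext (r_one x β)]
  refine Real.tendsto_exp_atBot.comp (tendsto_atBot_add_const_left _ _ ?_)
  refine Tendsto.pos_mul_atBot (C := -(Real.pi / 2) + Real.pi / (2 * β)) ?_ ?_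
    Real.tendsto_tan_neg_pi_div_two
  · have : Real.pi / 2 < Real.pi / (2 * β) := by
      gcongr
      linarith
    linarith
  · exact (Continuous.tendsto (by fun_prop) _).mono_left nhdsWithin_le_nhds

/-- At `β = 1` the coefficient of the tangent vanishes at `-π/2`. The product `(φ + π/2) tan φ`
tends to `-1`, because `cos φ / (φ + π/2)` is a difference quotient of the cosine with limit `1`. -/
theorem tendsto_r_one_left_tau (x : ℝ) :
    Tendsto (r x 1 1) (𝓝[>] (-(Real.pi / 2))) (𝓝 (tau x 1)) := by
  rw [funext (r_one x 1), tau, if_pos rfl]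
  refine (Real.continuous_exp.tendsto _).comp ?_
  have hx : -x - 1 = -x / 1 + -1 := by ring
  rw [hx]
  refine tendsto_const_nhds.add ?_
  have hslope : Tendsto (fun φ => (Real.cos φ / (φ + Real.pi / 2))⁻¹)
      (𝓝[>] (-(Real.pi / 2))) (𝓝 1⁻¹) := by
    have h1 := (Real.hasDerivAt_cos (-(Real.pi / 2)))
    rw [hasDerivAt_iff_tendsto_slope, Real.sin_neg, Real.sin_pi_div_two, neg_neg] at h1
    refine ((h1.mono_left (nhdsWithin_mono _ fun φ hφ => ne_of_gt hφ)).inv₀ one_ne_zero).congr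
      fun φ => ?_
    rw [slope_def_field, Real.cos_neg, Real.cos_pi_div_two, sub_zero, sub_neg_eq_add]
  have hsin : Tendsto Real.sin (𝓝[>] (-(Real.pi / 2))) (𝓝 (-1)) := by
    have := Real.continuous_sin.tendsto (-(Real.pi / 2))
    rw [Real.sin_neg, Real.sin_pi_div_two] at this
    exact this.mono_left nhdsWithin_le_nhds
  have := hslope.mul hsin
  rw [inv_one, one_mul] at this
  refine this.congr fun φ => ?_
  rw [Real.tan_eq_sin_div_cos, inv_div, mul_one]
  ring

/-- The value of the primitive at the initial point of the curve for `α = β = 1`. -/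
theorem radialPrimitive_one_neg_half_pi (n : ℕ) (x : ℝ) :
    radialPrimitive (hComplex n x 1 1) (polar (tau x 1) (-(Real.pi / 2))) =
      -Complex.I *
        (∫ s in (0 : ℝ)..tau x 1, Real.exp (x * s + s * Real.log s) * s ^ n : ℝ) := by
  have hτ : 0 < tau x 1 := by
    rw [tau, if_pos rfl]
    exact Real.exp_pos _
  rw [radialPrimitive_polar hτ fun s hs => ?_, exp_neg_half_pi_mul_I]
  rw [hComplex_one_polar hs.1 neg_half_pi_mem, I_mul_polar_neg_half_pi, mul_comm]
  simp
  exact Or.inl (by ring_nf)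

theorem main_one (n : ℕ) (x : ℝ) (hβ : 0 < β) (hβ1 : β ≤ 1) :
    IntervalIntegrable (fun φ => weight₁ x β φ * V n x 1 β φ) volume (-1) 1 ∧
    IntervalIntegrable (fun φ => weight₁ x β φ * W n x 1 β φ) volume (-1) 1 ∧
    (h n x 1 β).re = 1 / 2 * (∫ φ in (-1 : ℝ)..1, weight₁ x β φ * V n x 1 β φ) ∧
    (β ≠ 1 → (h n x 1 β).im =
      1 / 2 * (∫ φ in (-1 : ℝ)..1, weight₁ x β φ * W n x 1 β φ)) ∧
    (β = 1 → (h n x 1 β).im =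
      1 / 2 * (∫ φ in (-1 : ℝ)..1, weight₁ x β φ * W n x 1 β φ) -
        1 / Real.pi * ∫ s in (0 : ℝ)..tau x 1, Real.exp (x * s + s * Real.log s) * s ^ n) := by
  have hpi := Real.pi_pos
  have hcurve := polarCurve_one x hβ hβ1
  have hdecay := sectorDecay_one n x hβ
  have hleft : Real.pi / 2 * -1 = -(Real.pi / 2) := mul_neg_one _
  have hB := hcurve.tendsto_of_tendsto_atTop hdecay (eventually_mem_Ioo_right hcurve.lt)
    (tendsto_r_one_right x hβ)
  rcases hβ1.eq_or_lt with rfl | hlt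
  · have hA := PolarCurve.tendsto_of_tendsto_pos hdecay.toSlitHolomorphic
      (by rw [tau, if_pos rfl]; exact Real.exp_pos _) neg_half_pi_mem (tendsto_r_one_left_tau x)
    rw [radialPrimitive_one_neg_half_pi, ← hleft] at hA
    obtain ⟨h1, h2, h3, h4⟩ := integral_V_W hcurve hdecay
      (fun u hu => hComplex_one_curve hβ hu) hA hB
    refine ⟨h1, h2, ?_, fun hne => absurd rfl hne, fun _ => ?_⟩
    · rw [h3, h_eq, Complex.re_ofReal_mul, Complex.sub_re]
      simp only [neg_mul, Complex.neg_re, Complex.I_mul_re, Complex.ofReal_im]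
      field_simp
      ring
    · rw [h4, h_eq, Complex.im_ofReal_mul, Complex.sub_im]
      simp only [neg_mul, Complex.neg_im, Complex.I_mul_im, Complex.ofReal_re]
      field_simp
      ring
  · have hA := hcurve.tendsto_of_tendsto_zero hdecay.toSlitHolomorphic
      (eventually_mem_Ioo_left hcurve.lt) (by rw [hleft]; exact tendsto_r_one_left x hβ hlt)
    obtain ⟨h1, h2, h3, h4⟩ := integral_V_W hcurve hdecay
      (fun u hu => hComplex_one_curve hβ hu) hA hB
    refine ⟨h1, h2, ?_, fun _ => ?_, fun heq => absurd heq hlt.ne⟩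
    · rw [h3, h_eq, Complex.re_ofReal_mul, sub_zero]
      field_simp
    · rw [h4, h_eq, Complex.im_ofReal_mul, sub_zero]
      field_simp

end StableDensity

end

/-! ### Assembly of the cases. -/

theorem mainTheorem1 (n : ℕ) (x α β : ℝ) (hα0 : 0 < α) (hα2 : α < 2)
    (hβ0 : -1 ≤ β) (hβ1 : β ≤ 1) :
    -- the case `α ≠ 1`, `x > 0`
    (α ≠ 1 → 0 < x →
      IntegrableOn (StableDensity.hIntegrand n x α β) (Ioi 0) ∧
      -- real part, for all `β ∈ [-1, 1]`
      IntervalIntegrable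
        (fun φ => StableDensity.weight x α β φ * StableDensity.V n x α β φ)
        volume (-StableDensity.theta α β) 1 ∧
      (StableDensity.h n x α β).re =
        Real.sign (1 - α) / 2 * ∫ φ in (-StableDensity.theta α β)..1,
          StableDensity.weight x α β φ * StableDensity.V n x α β φ ∧
      -- imaginary part
      (-1 < β →
        IntervalIntegrable
          (fun φ => StableDensity.weight x α β φ * StableDensity.W n x α β φ)
          volume (-StableDensity.theta α β) 1 ∧
        (β ≠ 1 ∨ 1 < α →
          (StableDensity.h n x α β).im =
            Real.sign (1 - α) / 2 * ∫ φ in (-StableDensity.theta α β)..1,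
              StableDensity.weight x α β φ * StableDensity.W n x α β φ) ∧
        (β = 1 → α < 1 →
          (StableDensity.h n x α β).im =
            (1 / 2 * ∫ φ in (-StableDensity.theta α β)..1,
              StableDensity.weight x α β φ * StableDensity.W n x α β φ) -
            1 / Real.pi * ∫ s in (0 : ℝ)..StableDensity.tau x α,
              Real.exp (x * s - s ^ α) * s ^ n))) ∧
    -- the case `α = 1`, `β > 0`, with `x` an arbitrary real number
    (α = 1 → 0 < β →
      IntegrableOn (StableDensity.hIntegrand n x 1 β) (Ioi 0) ∧
      -- real part
      IntervalIntegrable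
        (fun φ => StableDensity.weight₁ x β φ * StableDensity.V n x 1 β φ)
        volume (-1) 1 ∧
      (StableDensity.h n x 1 β).re =
        1 / 2 * ∫ φ in (-1 : ℝ)..1,
          StableDensity.weight₁ x β φ * StableDensity.V n x 1 β φ ∧
      -- imaginary part
      IntervalIntegrable
        (fun φ => StableDensity.weight₁ x β φ * StableDensity.W n x 1 β φ)
        volume (-1) 1 ∧
      (β ≠ 1 →
        (StableDensity.h n x 1 β).im =
          1 / 2 * ∫ φ in (-1 : ℝ)..1,
            StableDensity.weight₁ x β φ * StableDensity.W n x 1 β φ) ∧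
      (β = 1 →
        (StableDensity.h n x 1 β).im =
          (1 / 2 * ∫ φ in (-1 : ℝ)..1,
            StableDensity.weight₁ x β φ * StableDensity.W n x 1 β φ) -
          1 / Real.pi * ∫ s in (0 : ℝ)..StableDensity.tau x 1,
            Real.exp (x * s + s * Real.log s) * s ^ n)) := by
  refine ⟨fun hα hx => ?_, fun _ hβ => ?_⟩
  · rcases hα.lt_or_gt with hα1 | hα1
    · have hsign : Real.sign (1 - α) = 1 := Real.sign_of_pos (by linarith)
      have hpi := Real.pi_pos
      have hdecay := StableDensity.sectorDecay_of_lt_one n (β := β) hα0 hα1 hx (by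
        rw [StableDensity.leftAngle_of_lt_one hα0 hα1, abs_le]
        constructor <;> nlinarith)
      rw [hsign]
      refine ⟨hdecay.integrableOn, ?_⟩
      rcases hβ0.eq_or_lt with rfl | hβ
      -- The interval of angles degenerates to a point, so the formula asserts that the real part of
      -- `h` is zero.
      · have hθ : -StableDensity.theta α (-1) = 1 := by
          rw [StableDensity.theta, StableDensity.K, hsign]
          field_simp
          ring
        rw [hθ]
        refine ⟨IntervalIntegrable.refl, ?_, fun hlt => absurd hlt (lt_irrefl _)⟩
        rw [StableDensity.h_re_of_lt_one_of_eq_neg_one hα0 hα1 hx, intervalIntegral.integral_same,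
          mul_zero]
      · obtain ⟨h1, h2, h3, h4, h5⟩ := StableDensity.main_of_lt_one n hα0 hα1 hx hβ hβ1
        exact ⟨h1, h3, fun _ => ⟨h2, fun hor => h4 (hor.resolve_right hα1.not_gt),
          fun hβ' _ => h5 hβ'⟩⟩
    · have hsign : Real.sign (1 - α) = -1 := Real.sign_of_neg (by linarith)
      have hs := StableDensity.sectorAngle_pos hα1 hα2
      have hdecay := StableDensity.sectorDecay_of_one_lt n (β := β) hα1 hα2 hx (by
        rw [StableDensity.leftAngle_of_one_lt hα1, abs_le]
        constructor <;> nlinarith)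
      obtain ⟨h1, h2, h3, h4⟩ := StableDensity.main_of_one_lt n hα1 hα2 hx hβ0 hβ1
      rw [hsign]
      exact ⟨hdecay.integrableOn, h1, h3, fun hβ =>
        ⟨h2, fun _ => h4 hβ, fun _ hlt => absurd hlt hα1.not_gt⟩⟩
  · obtain ⟨h1, h2, h3, h4, h5⟩ := StableDensity.main_one n x hβ hβ1
    exact ⟨(StableDensity.sectorDecay_one n x hβ).integrableOn, h1, h3, h2, h4, h5⟩
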